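/- Let $X$ be a compact connected Riemann surface of genus $g\ge 2$ with canonical bundle $K$, and let $D\subset X$ be a finite subset. A parabolic bundle $E_*$ is a holomorphic vector bundle $E$ on $X$ with, at each $p\in D$, a flag $E_p=E_{p,1}\supsetneq\dots\supsetneq E_{p,n_p}\supsetneq E_{p,n_p+1}=0$ and real weights $0\le\alpha_1(p)<\dots<\alpha_{n_p}(p)<1$; its parabolic degree is $\deg E+\sum_{p\in D}\sum_i\alpha_i(p)\dim(E_{p,i}/E_{p,i+1})$, and its parabolic slope is the parabolic degree divided by the rank. Let $(E_*,\varphi)$ be a symplectic parabolic bundle of rank $2m$: $\varphi:E_*\otimes E_*\to L_*$ is an alternating parabolic homomorphism to a parabolic line bundle $L_*$ for which the induced map $E_*\to L_*\otimes E_*^\vee$ is an isomorphism of parabolic bundles. Assume that $(E_*,\varphi)$ is stable: every nonzero isotropic holomorphic subbundle $F\subset E$, with the induced parabolic structure, has parabolic slope strictly smaller than that of $E_*$. Let $\mathcal W_{E,\mathrm{st}}=H^0(X,\mathrm{SPEnd}_{\mathrm{Sp}}(E_*)\otimes K(D))$ be the space of strongly parabolic symplectic Higgs fields, that is, of holomorphic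 homomorphisms $\Phi:E\to E\otimes K(D)$ with $\Phi(E_{p,i})\subset E_{p,i+1}\otimes K(D)|_p$ for all $p\in D$ and all $i$, and $\varphi(\Phi v,w)=-\varphi(v,\Phi w)$. Let $$h_{E,\mathrm{st}}:\mathcal W_{E,\mathrm{st}}\longrightarrow\mathcal A^{\mathrm{st}}_{\mathrm{Sp}}=\bigoplus_{i=1}^m H^0\bigl(X,K^{2i}(D^{2i-1})\bigr),\qquad \Phi\longmapsto(s_2,s_4,\dots,s_{2m}),$$ where $\det(x\cdot\mathrm{Id}-\Phi)=x^{2m}+s_2x^{2m-2}+\dots+s_{2m}$. Then $h_{E,\mathrm{st}}$ is a polynomial map, hence a morphism of affine spaces over $\mathbb C$, and the following are equivalent: 1. $(E_*,\varphi)$ is strongly very stable, i.e. the only nilpotent $\Phi\in\mathcal W_{E,\mathrm{st}}$ is $\Phi=0$; 2. $h_{E,\mathrm{st}}$ is finite; 3. $h_{E,\mathrm{st}}$ is proper; 4. $h_{E,\mathrm{st}}$ is quasi-finite. -/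

import Mathlib

open scoped Manifold ContDiff Topology
open Bundle AlgebraicGeometry CategoryTheory

universe u

noncomputable section

namespace ParabolicHiggs

/-! ### Local holomorphy on a Riemann surface -/

section Local

variable {X : Type u} [TopologicalSpace X] [ChartedSpace ℂ X]

/-- The complex valued function `f` is holomorphic in a neighbourhood of `p`. -/
def HolFunAt (f : X → ℂ) (p : X) : Prop := ContMDiffAt 𝓘(ℂ) 𝓘(ℂ) ω f p

/-- The section `s` of the holomorphic vector bundle `E` (with model fibre `F`) is holomorphic in a
neighbourhood of `p`. -/
def HolAt (F : Type*) [NormedAddCommGroup F] [NormedSpace ℂ F] {E : X → Type*}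
    [∀ x, TopologicalSpace (E x)] [TopologicalSpace (TotalSpace F E)] [FiberBundle F E]
    (s : ∀ x, E x) (p : X) : Prop :=
  ContMDiffAt 𝓘(ℂ) (𝓘(ℂ).prod 𝓘(ℂ, F)) ω (fun x => TotalSpace.mk' F x (s x)) p

/-- A local holomorphic coordinate centred at `p` (only used near `p`). -/
def coord (p x : X) : ℂ := chartAt ℂ p x - chartAt ℂ p p

/-- The holomorphic tangent space of the Riemann surface `X` at `x`. -/
abbrev T (x : X) : Type := TangentSpace 𝓘(ℂ) x

lemma holFunAt_coord [IsManifold 𝓘(ℂ) ω X] (p : X) : HolFunAt (coord p) p := by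
  have h := contMDiffAt_extChartAt (I := 𝓘(ℂ)) (n := ω) (x := p)
  exact ContMDiffAt.sub (by simpa [Function.comp_def] using h) contMDiffAt_const

@[simp] lemma coord_self (p : X) : coord p p = 0 := sub_self _

lemma coord_ne_zero (p : X) : ∀ᶠ x in 𝓝[≠] p, coord p x ≠ 0 := by
  have h1 : ∀ᶠ x in 𝓝[≠] p, x ∈ (chartAt ℂ p).source :=
    nhdsWithin_le_nhds ((chartAt ℂ p).open_source.mem_nhds (mem_chart_source ℂ p))
  filter_upwards [h1, self_mem_nhdsWithin] with x hx hne h0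
  exact hne ((chartAt ℂ p).injOn hx (mem_chart_source ℂ p) (sub_eq_zero.mp h0))

lemma neBot_punctured (p : X) : (𝓝[≠] p).NeBot := by
  by_contra h
  rw [Filter.not_neBot, ← isOpen_singleton_iff_punctured_nhds] at h
  have h2 := (chartAt ℂ p).isOpen_image_of_subset_source h
    (Set.singleton_subset_iff.mpr (mem_chart_source ℂ p))
  rw [Set.image_singleton] at h2
  exact not_isOpen_singleton _ h2

/-- A holomorphic function vanishing at `p` is divisible by the local coordinate. -/
lemma HolFunAt.exists_eq_coord_mul [IsManifold 𝓘(ℂ) ω X] {f : X → ℂ} {p : X}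
    (hf : HolFunAt f p) (h0 : f p = 0) :
    ∃ g : X → ℂ, HolFunAt g p ∧ ∀ᶠ x in 𝓝 p, f x = coord p x * g x := by
  set z₀ := chartAt ℂ p p with hz
  set G : ℂ → ℂ := f ∘ (chartAt ℂ p).symm with hG
  have hA : AnalyticAt ℂ G z₀ := by
    have h := (contMDiffAt_iff.mp hf).2
    simp only [modelWithCornersSelf_coe, Set.range_id, contDiffWithinAt_univ] at h
    have h' : ContDiffAt ℂ ω G z₀ := by
      simpa [Function.comp_def, hG, hz, chartAt_self_eq] using h
    exact h'.analyticAt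
  obtain ⟨q, hq⟩ := hA
  have hd : AnalyticAt ℂ (dslope G z₀) z₀ := ⟨_, hq.has_fpower_series_dslope_fslope⟩
  refine ⟨fun x => dslope G z₀ (chartAt ℂ p x), ?_, ?_⟩
  · have h1 := contMDiffAt_extChartAt (I := 𝓘(ℂ)) (n := ω) (x := p)
    have h2 : ContMDiffAt 𝓘(ℂ) 𝓘(ℂ) ω (chartAt ℂ p) p := by simpa [Function.comp_def] using h1
    exact ContMDiffAt.comp p (hd.contDiffAt.contMDiffAt) h2
  · filter_upwards [(chartAt ℂ p).open_source.mem_nhds (mem_chart_source ℂ p)] with x hx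
    have h := sub_smul_dslope G z₀ (chartAt ℂ p x)
    have e1 : G (chartAt ℂ p x) = f x := by simp [hG, (chartAt ℂ p).left_inv hx]
    have e2 : G z₀ = 0 := by simp [hG, hz, (chartAt ℂ p).left_inv (mem_chart_source ℂ p), h0]
    rw [e1, e2, sub_zero] at h
    rw [← h]; rfl

lemma HolFunAt.mul {f g : X → ℂ} {p : X} (hf : HolFunAt f p) (hg : HolFunAt g p) :
    HolFunAt (fun x => f x * g x) p := ContMDiffAt.mul hf hg

lemma HolFunAt.add {f g : X → ℂ} {p : X} (hf : HolFunAt f p) (hg : HolFunAt g p) :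
    HolFunAt (fun x => f x + g x) p := ContMDiffAt.add hf hg

lemma HolFunAt.const (c : ℂ) (p : X) : HolFunAt (fun _ => c) p := contMDiffAt_const

lemma HolFunAt.mvPolynomial_eval {σ : Type*} (P : MvPolynomial σ ℂ) {f : σ → X → ℂ} {p : X}
    (hf : ∀ i, HolFunAt (f i) p) : HolFunAt (fun x => MvPolynomial.eval (fun i => f i x) P) p := by
  induction P using MvPolynomial.induction_on with
  | C a => simpa using HolFunAt.const a p
  | add P Q hP hQ => simpa using hP.add hQ
  | mul_X P i hP => simpa using hP.mul (hf i)

section Sections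

variable {F : Type*} [NormedAddCommGroup F] [NormedSpace ℂ F] {E : X → Type*}
    [∀ x, TopologicalSpace (E x)] [TopologicalSpace (TotalSpace F E)] [FiberBundle F E]
    [∀ x, AddCommGroup (E x)] [∀ x, Module ℂ (E x)] [VectorBundle ℂ F E]

lemma HolAt.add {s t : ∀ x, E x} {p : X} (hs : HolAt F s p) (ht : HolAt F t p) :
    HolAt F (fun x => s x + t x) p := ContMDiffAt.add_section hs ht

lemma HolAt.smul {f : X → ℂ} {s : ∀ x, E x} {p : X} (hf : HolFunAt f p) (hs : HolAt F s p) :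
    HolAt F (fun x => f x • s x) p := ContMDiffAt.smul_section hf hs

lemma HolAt.zero (p : X) : HolAt F (fun x => (0 : E x)) p := by
  classical
  have := ContMDiffAt.sum_section (I := 𝓘(ℂ)) (F := F) (V := E) (n := ω) (x₀ := p)
    (t := fun (_ : ℕ) x => (0 : E x)) (s := ∅) (by simp)
  simpa [HolAt] using this

lemma HolAt.sum {ι : Type*} (a : Finset ι) {s : ι → ∀ x, E x} {p : X}
    (hs : ∀ i, HolAt F (s i) p) : HolAt F (fun x => ∑ i ∈ a, s i x) p :=
  ContMDiffAt.sum_section fun i _ => hs i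

end Sections

end Local

/-! ### Line bundles of pluricanonical forms with poles -/

section Differentials

variable {X : Type u} [TopologicalSpace X] [ChartedSpace ℂ X] [IsManifold 𝓘(ℂ) ω X]

/-- `H⁰(X, K^a(D^b))`: the holomorphic sections of `K^a` over `X ∖ D` whose poles at the
points of `D` have order at most `b`. An element of the fibre of `K^a` at `x` is a function on the
(one dimensional) tangent space `T x` which is homogeneous of degree `a`. Sections over `X ∖ D` are
extended by zero to `D`. -/
def differentials (D : Finset X) (a b : ℕ) : Submodule ℂ (∀ x : X, T x → ℂ) where
  carrier := {q |
    (∀ x (c : ℂ) (v : T x), q x (c • v) = c ^ a * q x v) ∧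
    (∀ p ∈ D, q p = 0) ∧
    (∀ p ∉ D, ∀ v : ∀ x : X, T x, HolAt ℂ v p → HolFunAt (fun x => q x (v x)) p) ∧
    (∀ p ∈ D, ∀ v : ∀ x : X, T x, HolAt ℂ v p →
      ∃ g : X → ℂ, HolFunAt g p ∧ ∀ᶠ x in 𝓝[≠] p, g x = coord p x ^ b * q x (v x))}
  zero_mem' := by
    refine ⟨fun _ _ _ => by simp, fun _ _ => rfl, fun p _ _ _ => HolFunAt.const 0 p,
      fun p _ _ _ => ⟨fun _ => 0, HolFunAt.const 0 p, by simp⟩⟩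
  add_mem' := by
    rintro q r ⟨h1, h2, h3, h4⟩ ⟨k1, k2, k3, k4⟩
    refine ⟨fun x c v => by simp [h1, k1, mul_add], fun p hp => by simp [h2 p hp, k2 p hp],
      fun p hp v hv => (h3 p hp v hv).add (k3 p hp v hv), fun p hp v hv => ?_⟩
    obtain ⟨g, hg, hg'⟩ := h4 p hp v hv
    obtain ⟨g₂, hg₂, hg₂'⟩ := k4 p hp v hv
    refine ⟨_, hg.add hg₂, ?_⟩
    filter_upwards [hg', hg₂'] with x e1 e2
    simp [e1, e2, mul_add]
  smul_mem' := by
    rintro d q ⟨h1, h2, h3, h4⟩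
    refine ⟨fun x c v => by simp [h1, mul_left_comm], fun p hp => by simp [h2 p hp],
      fun p hp v hv => (HolFunAt.const d p).mul (h3 p hp v hv), fun p hp v hv => ?_⟩
    obtain ⟨g, hg, hg'⟩ := h4 p hp v hv
    refine ⟨_, (HolFunAt.const d p).mul hg, ?_⟩
    filter_upwards [hg'] with x e1
    simp [e1, mul_left_comm]

variable (X) in
/-- The genus `dim H⁰(X, K)` of a compact Riemann surface. -/
def genus : ℕ := Module.finrank ℂ (differentials (∅ : Finset X) 1 0)

end Differentials

/-! ### Parabolic structures -/

/-- A weighted flag on a vector space: a strictly decreasing filtration from the whole space to `0`,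
with strictly increasing weights in `[0, 1)`; `weight i` is attached to `flag i`. -/
structure WeightedFlag (V : Type*) [AddCommGroup V] [Module ℂ V] where
  len : ℕ
  flag : Fin (len + 1) → Submodule ℂ V
  flag_strictAnti : StrictAnti flag
  flag_zero : flag 0 = ⊤
  flag_last : flag (Fin.last len) = ⊥
  weight : Fin len → ℝ
  weight_strictMono : StrictMono weight
  weight_nonneg : ∀ i, 0 ≤ weight i
  weight_lt_one : ∀ i, weight i < 1

/-- The largest step of the flag whose weight is at least `r` (`0` if there is none). -/
def WeightedFlag.step {V : Type*} [AddCommGroup V] [Module ℂ V] (W : WeightedFlag V) (r : ℝ) :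
    Submodule ℂ V :=
  ⨆ (i : Fin W.len) (_ : r ≤ W.weight i), W.flag i.castSucc

/-- A parabolic structure along `D` on the vector bundle `E`. -/
abbrev ParabolicStructure {X : Type u} (D : Finset X) (E : X → Type*) [∀ x, AddCommGroup (E x)]
    [∀ x, Module ℂ (E x)] :=
  ∀ p : {x // x ∈ D}, WeightedFlag (E p)

section Parabolic

variable {X : Type u} [TopologicalSpace X] [ChartedSpace ℂ X] {D : Finset X}
variable (F : Type*) [NormedAddCommGroup F] [NormedSpace ℂ F] {E : X → Type*}
    [∀ x, TopologicalSpace (E x)] [TopologicalSpace (TotalSpace F E)] [FiberBundle F E]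
    [∀ x, AddCommGroup (E x)] [∀ x, Module ℂ (E x)]

/-- The `ℝ`-filtered sheaf `E_t` attached to a parabolic bundle, on germs at the parabolic
point `p` of sections over punctured neighbourhoods: for `0 ≤ t < 1`, `E_t` consists of
the holomorphic sections of `E` whose value at `p` lies in the step of weight `≥ t`, and
`E_{t + 1} = E_t(-p)`. -/
def InFiltration (P : ParabolicStructure D E) (p : {x // x ∈ D}) (t : ℝ) (s : ∀ x, E x) : Prop :=
  ∃ τ : ∀ x, E x, HolAt F τ p.1 ∧ τ p.1 ∈ (P p).step (Int.fract t) ∧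
    ∀ᶠ x in 𝓝[≠] p.1, s x = coord p.1 x ^ ⌊t⌋ • τ x

/-- `f` is a holomorphic frame near `p` of the family of subspaces `G x ⊆ E x`. -/
def IsFrameAt (G : ∀ x, Submodule ℂ (E x)) {k : ℕ} (f : Fin k → ∀ x, E x) (p : X) : Prop :=
  (∀ j, HolAt F (f j) p) ∧
    ∀ᶠ x in 𝓝 p, LinearIndependent ℂ (fun j => f j x) ∧
      Submodule.span ℂ (Set.range fun j => f j x) = G x

/-- `G` is a holomorphic subbundle of rank `k` of `E`. -/
def IsSubbundle (k : ℕ) (G : ∀ x, Submodule ℂ (E x)) : Prop :=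
  ∀ p, ∃ f : Fin k → ∀ x, E x, IsFrameAt F G f p

/-- The rank `k` subbundle `G` of `E` has degree `d`: there is a nonzero meromorphic section `σ`
of the line bundle `⋀ᵏ G` with divisor `ord`, and `d` is the degree of this divisor. -/
def HasDegree (k : ℕ) (G : ∀ x, Submodule ℂ (E x)) (d : ℤ) : Prop :=
  ∃ (σ : ∀ x, ⋀[ℂ]^k (E x)) (ord : X →₀ ℤ),
    (∀ p, ∃ (f : Fin k → ∀ x, E x) (h : X → ℂ), IsFrameAt F G f p ∧ HolFunAt h p ∧ h p ≠ 0 ∧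
      ∀ᶠ x in 𝓝[≠] p,
        σ x = (coord p x ^ ord p * h x) • exteriorPower.ιMulti ℂ k (fun j => f j x)) ∧
    d = ord.sum fun _ a => a

/-- The parabolic degree of a subbundle `G` of degree `d`, with the induced parabolic
structure: the filtration `G_p ∩ E_{p,i}`, where the weight of each jump is the largest possible one
(steps at which the intersection does not jump contribute zero). -/
def parDeg (P : ParabolicStructure D E) (G : ∀ x, Submodule ℂ (E x)) (d : ℤ) : ℝ :=
  d + ∑ p : {x // x ∈ D}, ∑ i : Fin (P p).len, (P p).weight i *
    ((Module.finrank ℂ ↥(G p.1 ⊓ (P p).flag i.castSucc) : ℝ)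
      - Module.finrank ℂ ↥(G p.1 ⊓ (P p).flag i.succ))

end Parabolic

/-! ### Symplectic parabolic bundles -/

section Symplectic

variable {X : Type u} [TopologicalSpace X] [ChartedSpace ℂ X] {D : Finset X}
variable (F : Type*) [NormedAddCommGroup F] [NormedSpace ℂ F] {E : X → Type*}
    [∀ x, TopologicalSpace (E x)] [TopologicalSpace (TotalSpace F E)] [FiberBundle F E]
    [∀ x, AddCommGroup (E x)] [∀ x, Module ℂ (E x)]
    {L : X → Type*}
    [∀ x, TopologicalSpace (L x)] [TopologicalSpace (TotalSpace ℂ L)] [FiberBundle ℂ L]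
    [∀ x, AddCommGroup (L x)] [∀ x, Module ℂ (L x)]

/-- `φ : E_* ⊗ E_* → L_*` makes `(E_*, φ)` a symplectic parabolic bundle: `φ` is an alternating
parabolic homomorphism and the induced map `E_* → L_* ⊗ E_*^∨` is an isomorphism of parabolic
bundles. The filtration of `E_* ⊗ E_*` is `(E ⊗ E)_c = ∑_{a+b=c} E_a ⊗ E_b`, and the sections of
`(L ⊗ E^∨)_a` are the homomorphisms carrying `E_b` into `L_{a+b}` for all `b`. -/
structure IsSymplectic (PE : ParabolicStructure D E) (PL : ParabolicStructure D L)
    (φ : ∀ x, E x →ₗ[ℂ] E x →ₗ[ℂ] L x) : Prop where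
  holomorphic : ∀ (p : X) (s t : ∀ x, E x), HolAt F s p → HolAt F t p →
    HolAt ℂ (fun x => φ x (s x) (t x)) p
  alternating : ∀ x (v : E x), φ x v v = 0
  parabolic : ∀ (p : {x // x ∈ D}) (a b : ℝ) (s t : ∀ x, E x),
    InFiltration F PE p a s → InFiltration F PE p b t →
      InFiltration ℂ PL p (a + b) (fun x => φ x (s x) (t x))
  /-- the induced map is injective on fibres, hence an isomorphism, away from `D` -/
  nondegenerate : ∀ x ∉ D, ∀ v : E x, (∀ w, φ x v w = 0) → v = 0
  /-- the induced map `E_a → (L ⊗ E^∨)_a` is surjective on germs at the points of `D` -/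
  surjective : ∀ (p : {x // x ∈ D}) (a : ℝ) (f : ∀ x, E x →ₗ[ℂ] L x),
    (∀ (b : ℝ) (t : ∀ x, E x), InFiltration F PE p b t →
      InFiltration ℂ PL p (a + b) (fun x => f x (t x))) →
    ∃ s : ∀ x, E x, InFiltration F PE p a s ∧ ∀ᶠ x in 𝓝[≠] p.1, φ x (s x) = f x

/-- Stability of the symplectic parabolic bundle `(E_*, φ)`: every nonzero isotropic subbundle `G`
has smaller parabolic slope than `E_*`. -/
def IsStable (PE : ParabolicStructure D E) (φ : ∀ x, E x →ₗ[ℂ] E x →ₗ[ℂ] L x) : Prop :=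
  ∀ (k : ℕ) (G : ∀ x, Submodule ℂ (E x)), 0 < k → IsSubbundle F k G →
    (∀ x, ∀ v ∈ G x, ∀ w ∈ G x, φ x v w = 0) →
    ∀ d e : ℤ, HasDegree F k G d →
      HasDegree F (Module.finrank ℂ F) (fun x => (⊤ : Submodule ℂ (E x))) e →
      parDeg PE G d / k < parDeg PE (fun _ => ⊤) e / Module.finrank ℂ F

variable [IsManifold 𝓘(ℂ) ω X] [VectorBundle ℂ F E]

/-- `H⁰(X, SPEnd_Sp(E_*) ⊗ K(D))`: the strongly parabolic symplectic Higgs fields. Over `X ∖ D` such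
a field is a holomorphic homomorphism `E → E ⊗ K`, i.e. it sends a tangent vector at `x` to an
endomorphism of `E x`; it is extended by zero to `D`. At `p ∈ D` it has at most a simple pole,
and, as a map `E → E ⊗ K(D)`, it carries `E_{p,i}` into `E_{p,i+1} ⊗ K(D)_p`. It is skew
with respect to `φ`. -/
def higgsFields (PE : ParabolicStructure D E) (φ : ∀ x, E x →ₗ[ℂ] E x →ₗ[ℂ] L x) :
    Submodule ℂ (∀ x : X, T x →ₗ[ℂ] Module.End ℂ (E x)) where
  carrier := {Φ |
    (∀ p ∈ D, Φ p = 0) ∧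
    (∀ p ∉ D, ∀ (v : ∀ x : X, T x) (s : ∀ x, E x), HolAt ℂ v p → HolAt F s p →
      HolAt F (fun x => Φ x (v x) (s x)) p) ∧
    (∀ (p : {x // x ∈ D}) (v : ∀ x : X, T x) (s : ∀ x, E x), HolAt ℂ v p.1 → HolAt F s p.1 →
      ∀ i : Fin (PE p).len, s p.1 ∈ (PE p).flag i.castSucc →
        ∃ τ : ∀ x, E x, HolAt F τ p.1 ∧ τ p.1 ∈ (PE p).flag i.succ ∧
          ∀ᶠ x in 𝓝[≠] p.1, τ x = coord p.1 x • Φ x (v x) (s x)) ∧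
    (∀ x (u : T x) (v w : E x), φ x (Φ x u v) w = - φ x v (Φ x u w))}
  zero_mem' := by
    refine ⟨fun _ _ => rfl, fun p _ v s _ _ => HolAt.zero p, fun p v s _ _ i _ => ?_, by simp⟩
    exact ⟨fun _ => 0, HolAt.zero p.1, Submodule.zero_mem _, by simp⟩
  add_mem' := by
    rintro Φ Ψ ⟨h1, h2, h3, h4⟩ ⟨k1, k2, k3, k4⟩
    refine ⟨fun p hp => by simp [h1 p hp, k1 p hp],
      fun p hp v s hv hs => (h2 p hp v s hv hs).add (k2 p hp v s hv hs),
      fun p v s hv hs i hi => ?_, fun x u v w => by simp [h4, k4, add_comm]⟩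
    obtain ⟨τ, a1, a2, a3⟩ := h3 p v s hv hs i hi
    obtain ⟨τ', b1, b2, b3⟩ := k3 p v s hv hs i hi
    refine ⟨_, a1.add b1, Submodule.add_mem _ a2 b2, ?_⟩
    filter_upwards [a3, b3] with x e1 e2
    simp [e1, e2]
  smul_mem' := by
    rintro c Φ ⟨h1, h2, h3, h4⟩
    refine ⟨fun p hp => by simp [h1 p hp],
      fun p hp v s hv hs => HolAt.smul (HolFunAt.const c p) (h2 p hp v s hv hs),
      fun p v s hv hs i hi => ?_, fun x u v w => by
        have := h4 x u v w
        simp only [Pi.smul_apply, LinearMap.smul_apply, map_smul, this, smul_neg]⟩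
    obtain ⟨τ, a1, a2, a3⟩ := h3 p v s hv hs i hi
    refine ⟨_, HolAt.smul (HolFunAt.const c p.1) a1, Submodule.smul_mem _ c a2, ?_⟩
    filter_upwards [a3] with x e1
    rw [e1]
    exact smul_comm _ _ _

/-- `(E_*, φ)` is strongly very stable: it has no nonzero nilpotent strongly parabolic symplectic
Higgs field. -/
def IsStronglyVeryStable (PE : ParabolicStructure D E) (φ : ∀ x, E x →ₗ[ℂ] E x →ₗ[ℂ] L x) : Prop :=
  ∀ Φ ∈ higgsFields F PE φ, (∀ x (u : T x), IsNilpotent (Φ x u)) → Φ = 0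

end Symplectic

/-! ### The Hitchin map -/

section CharPoly

lemma eval_smul_of_isHomogeneous {σ : Type*} {P : MvPolynomial σ ℂ} {k : ℕ}
    (hP : P.IsHomogeneous k) (c : ℂ) (f : σ → ℂ) :
    MvPolynomial.eval (fun i => c * f i) P = c ^ k * MvPolynomial.eval f P := by
  rw [MvPolynomial.eval_eq, MvPolynomial.eval_eq, Finset.mul_sum]
  refine Finset.sum_congr rfl fun d hd => ?_
  have h : ∑ i ∈ d.support, d i = k := by
    have := hP (MvPolynomial.mem_support_iff.mp hd)
    simpa [Finsupp.weight_apply, Finsupp.sum] using this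
  simp only [mul_pow, Finset.prod_mul_distrib, Finset.prod_pow_eq_pow_sum, h]
  ring

lemma charpoly_coeff_eq_eval {n : ℕ} (M : Matrix (Fin n) (Fin n) ℂ) (k : ℕ) :
    M.charpoly.coeff k =
      MvPolynomial.eval (fun ij => M ij.1 ij.2) ((Matrix.charpoly.univ ℂ (Fin n)).coeff k) := by
  have h := Matrix.charpoly.univ_coeff_eval₂Hom (n := Fin n) (RingHom.id ℂ)
    (fun ij : Fin n × Fin n => M ij.1 ij.2) k
  exact h.symm

lemma matrix_charpoly_coeff_smul {n : ℕ} (c : ℂ) (M : Matrix (Fin n) (Fin n) ℂ) {j : ℕ}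
    (hj : j ≤ n) : (c • M).charpoly.coeff (n - j) = c ^ j * M.charpoly.coeff (n - j) := by
  rw [charpoly_coeff_eq_eval, charpoly_coeff_eq_eval, ← eval_smul_of_isHomogeneous
    (Matrix.charpoly.univ_coeff_isHomogeneous ℂ (n := Fin n) (n - j) j (by simp; omega))]
  rfl

lemma charpoly_coeff_smul {V : Type*} [AddCommGroup V] [Module ℂ V] [FiniteDimensional ℂ V]
    (c : ℂ) (A : Module.End ℂ V) {j : ℕ} (hj : j ≤ Module.finrank ℂ V) :
    (c • A).charpoly.coeff (Module.finrank ℂ V - j)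
      = c ^ j * A.charpoly.coeff (Module.finrank ℂ V - j) := by
  rw [← LinearMap.charpoly_toMatrix (c • A) (Module.finBasis ℂ V),
    ← LinearMap.charpoly_toMatrix A (Module.finBasis ℂ V), map_smul,
    matrix_charpoly_coeff_smul c _ hj]

/-- An endomorphism moving each step of a flag into the next one is nilpotent. -/
lemma WeightedFlag.isNilpotent {V : Type*} [AddCommGroup V] [Module ℂ V] (W : WeightedFlag V)
    (A : Module.End ℂ V) (hA : ∀ i : Fin W.len, ∀ v ∈ W.flag i.castSucc, A v ∈ W.flag i.succ) :
    IsNilpotent A := by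
  have key : ∀ k (hk : k < W.len + 1) (v : V), (A ^ k) v ∈ W.flag ⟨k, hk⟩ := by
    intro k
    induction k with
    | zero => intro hk v; exact W.flag_zero ▸ Submodule.mem_top
    | succ k ih =>
      intro hk v
      rw [pow_succ']
      exact hA ⟨k, by omega⟩ _ (ih (by omega) v)
  refine ⟨W.len, LinearMap.ext fun v => ?_⟩
  have h := key W.len (Nat.lt_succ_self _) v
  have h' : W.flag ⟨W.len, Nat.lt_succ_self _⟩ = ⊥ := W.flag_last
  rw [h'] at h
  simpa using h

end CharPoly

section Hitchin

variable {X : Type u} [TopologicalSpace X] [ChartedSpace ℂ X] [IsManifold 𝓘(ℂ) ω X] {D : Finset X}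
variable (F : Type*) [NormedAddCommGroup F] [NormedSpace ℂ F] [FiniteDimensional ℂ F]
    {E : X → Type*}
    [∀ x, TopologicalSpace (E x)] [TopologicalSpace (TotalSpace F E)] [FiberBundle F E]
    [∀ x, AddCommGroup (E x)] [∀ x, Module ℂ (E x)] [VectorBundle ℂ F E]
    {L : X → Type*} [∀ x, AddCommGroup (L x)] [∀ x, Module ℂ (L x)]

/-- The coefficient `s_j` of `det (t - Φ) = tⁿ + s₁ tⁿ⁻¹ + ⋯ + sₙ`, a `j`-form. -/
def charCoeff (Φ : ∀ x : X, T x →ₗ[ℂ] Module.End ℂ (E x)) (j : ℕ) (x : X) (u : T x) : ℂ :=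
  haveI := VectorBundle.finiteDimensional ℂ F E x
  (Φ x u).charpoly.coeff (Module.finrank ℂ F - j)

/-- The matrix, in the frame of a trivialization around `p`, of a family of endomorphisms whose
values on the frame are the sections `τ j`. -/
def frameMatrix [ContMDiffVectorBundle ω F E 𝓘(ℂ)] (p : X)
    (τ : Fin (Module.finrank ℂ F) → ∀ x, E x) (x : X) :
    Matrix (Fin (Module.finrank ℂ F)) (Fin (Module.finrank ℂ F)) ℂ :=
  have : ContMDiffVectorBundle 1 F E 𝓘(ℂ) := .of_le (n := ω) le_top
  Matrix.of fun i j =>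
    (trivializationAt F E p).localFrameCoeff 𝓘(ℂ) (Module.finBasis ℂ F) i x (τ j x)

/-- The local frame given by a trivialization around `p`. -/
def frameSec (p : X) (j : Fin (Module.finrank ℂ F)) : ∀ x, E x :=
  (trivializationAt F E p).localFrame (Module.finBasis ℂ F) j

variable [ContMDiffVectorBundle ω F E 𝓘(ℂ)]

set_option linter.unusedSectionVars false

lemma holAt_frameSec (p : X) (j) : HolAt F (frameSec F p j : ∀ x, E x) p :=
  contMDiffAt_localFrame_of_mem ω _ _ j (FiberBundle.mem_baseSet_trivializationAt F E p)

lemma holFunAt_frameMatrix (p : X) {τ : Fin (Module.finrank ℂ F) → ∀ x, E x}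
    (hτ : ∀ j, HolAt F (τ j) p) (k : ℕ) :
    HolFunAt (fun x => (frameMatrix F p τ x).charpoly.coeff k) p := by
  have : ContMDiffVectorBundle 1 F E 𝓘(ℂ) := .of_le (n := ω) le_top
  simp_rw [charpoly_coeff_eq_eval]
  refine HolFunAt.mvPolynomial_eval _ fun ij => ?_
  exact contMDiffAt_localFrameCoeff _
    (FiberBundle.mem_baseSet_trivializationAt F E p) (hτ ij.2) ij.1

lemma charpoly_eq_frameMatrix (p : X) {x : X} (hx : x ∈ (trivializationAt F E p).baseSet)
    [FiniteDimensional ℂ (E x)] (A : Module.End ℂ (E x)) {τ : Fin (Module.finrank ℂ F) → ∀ x, E x}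
    (h : ∀ j, A (frameSec F p j x) = τ j x) :
    A.charpoly = (frameMatrix F p τ x).charpoly := by
  have : ContMDiffVectorBundle 1 F E 𝓘(ℂ) := .of_le (n := ω) le_top
  rw [← LinearMap.charpoly_toMatrix A ((trivializationAt F E p).basisAt (Module.finBasis ℂ F) hx)]
  congr 1
  ext i j
  have hj := h j
  rw [frameSec, Bundle.Trivialization.localFrame_apply_of_mem_baseSet _ _ hx] at hj
  simp only [frameMatrix, LinearMap.toMatrix_apply, Matrix.of_apply, hj]
  exact (Bundle.Trivialization.localFrameCoeff_apply_of_mem_baseSet _ _ hx _ _).symm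

/-- Sections which agree on a punctured neighbourhood agree at the centre. -/
lemma HolAt.eq_of_eventuallyEq {p : X} {s t : ∀ x, E x} (hs : HolAt F s p) (ht : HolAt F t p)
    (h : ∀ᶠ x in 𝓝[≠] p, s x = t x) : s p = t p := by
  have : ContMDiffVectorBundle 1 F E 𝓘(ℂ) := .of_le (n := ω) le_top
  have := neBot_punctured p
  have hp := FiberBundle.mem_baseSet_trivializationAt F E p
  apply ((trivializationAt F E p).basisAt (Module.finBasis ℂ F) hp).ext_elem
  intro i
  rw [← Bundle.Trivialization.localFrameCoeff_apply_of_mem_baseSet (I := 𝓘(ℂ)) _ _ hp s,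
    ← Bundle.Trivialization.localFrameCoeff_apply_of_mem_baseSet (I := 𝓘(ℂ)) _ _ hp t]
  have cs := (contMDiffAt_localFrameCoeff (Module.finBasis ℂ F) hp hs i).continuousAt
  have ct := (contMDiffAt_localFrameCoeff (Module.finBasis ℂ F) hp ht i).continuousAt
  refine tendsto_nhds_unique (l := 𝓝[≠] p) (cs.tendsto.mono_left nhdsWithin_le_nhds)
    ((ct.tendsto.mono_left nhdsWithin_le_nhds).congr' ?_)
  filter_upwards [h] with x hx
  simp [LinearMap.piApply, hx]

/-- The characteristic coefficient `s_{j+1}` of a strongly parabolic Higgs field lies in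
`H⁰(X, K^{j+1}(D^j))`. -/
lemma charCoeff_mem {PE : ParabolicStructure D E} {φ : ∀ x, E x →ₗ[ℂ] E x →ₗ[ℂ] L x}
    [∀ x, TopologicalSpace (L x)] [TopologicalSpace (TotalSpace ℂ L)] [FiberBundle ℂ L]
    {Φ : ∀ x : X, T x →ₗ[ℂ] Module.End ℂ (E x)} (hΦ : Φ ∈ higgsFields F PE φ) (j : ℕ)
    (hj : j + 1 ≤ Module.finrank ℂ F) :
    charCoeff F Φ (j + 1) ∈ differentials D (j + 1) j := by
  obtain ⟨h1, h2, h3, -⟩ := hΦ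
  have hfr : ∀ x, Module.finrank ℂ (E x) = Module.finrank ℂ F :=
    fun x => VectorBundle.finrank_eq ℂ F E x
  refine ⟨fun x c v => ?_, fun p hp => ?_, fun p hp v hv => ?_, fun p hp v hv => ?_⟩
  · haveI := VectorBundle.finiteDimensional ℂ F E x
    have := charpoly_coeff_smul c (Φ x v) (j := j + 1) (by rw [hfr]; exact hj)
    rw [hfr] at this
    simpa only [charCoeff, map_smul] using this
  · funext u
    have := VectorBundle.finiteDimensional ℂ F E p
    have : (Φ p u) = 0 := by rw [h1 p hp]; rfl
    simp only [charCoeff, this, Pi.zero_apply]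
    rw [LinearMap.charpoly_zero, hfr, Polynomial.coeff_X_pow, if_neg (by omega)]
  · refine (holFunAt_frameMatrix F p (fun i => h2 p hp v _ hv (holAt_frameSec F p i))
      (Module.finrank ℂ F - (j + 1))).congr_of_eventuallyEq ?_
    filter_upwards [(trivializationAt F E p).open_baseSet.mem_nhds
      (FiberBundle.mem_baseSet_trivializationAt F E p)] with x hx
    have fdx := VectorBundle.finiteDimensional ℂ F E x
    simp only [charCoeff]
    rw [charpoly_eq_frameMatrix F p hx (Φ x (v x))
      (τ := fun i x => Φ x (v x) (frameSec F p i x)) fun i => rfl]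
  · have hbase := (trivializationAt F E p).open_baseSet.mem_nhds
      (FiberBundle.mem_baseSet_trivializationAt F E p)
    have hbp := FiberBundle.mem_baseSet_trivializationAt F E p
    have fdp := VectorBundle.finiteDimensional ℂ F E p
    have hlen : 0 < (PE ⟨p, hp⟩).len := by
      by_contra h0
      have h0' : (0 : Fin ((PE ⟨p, hp⟩).len + 1)) = Fin.last _ := Fin.ext (by simp; omega)
      have htop := (PE ⟨p, hp⟩).flag_zero
      rw [h0', (PE ⟨p, hp⟩).flag_last] at htop
      have h3 := finrank_top ℂ (E p)
      rw [← htop, finrank_bot, hfr] at h3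
      omega
    choose τ hτ _ hτΦ using fun i => h3 ⟨p, hp⟩ v _ hv (holAt_frameSec F p i) ⟨0, hlen⟩ (by
      have : (PE ⟨p, hp⟩).flag (Fin.castSucc ⟨0, hlen⟩) = ⊤ := (PE ⟨p, hp⟩).flag_zero
      rw [this]; trivial)
    set b := (trivializationAt F E p).basisAt (Module.finBasis ℂ F) hbp with hb
    have hbs : ∀ i, b i = frameSec F p i p := fun i => by
      rw [frameSec, Bundle.Trivialization.localFrame_apply_of_mem_baseSet _ _ hbp]
    let A : Module.End ℂ (E p) := b.constr ℂ fun i => τ i p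
    have hAb : ∀ i, A (frameSec F p i p) = τ i p := fun i => by
      rw [← hbs]; exact b.constr_basis ℂ _ i
    have hA : IsNilpotent A := by
      refine (PE ⟨p, hp⟩).isNilpotent A fun i w hw => ?_
      have hw' : ∑ k, b.repr w k • frameSec F p k p = w := by
        simp_rw [← hbs]; exact b.sum_repr w
      obtain ⟨ρ, r1, r2, r3⟩ := h3 ⟨p, hp⟩ v
        (fun x => ∑ k, b.repr w k • frameSec F p k x) hv
        (HolAt.sum _ fun k => HolAt.smul (HolFunAt.const _ p) (holAt_frameSec F p k)) i
        (by simpa only [hw'] using hw)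
      have hρ : ρ p = ∑ k, b.repr w k • τ k p := by
        refine HolAt.eq_of_eventuallyEq F (t := fun x => ∑ k, b.repr w k • τ k x) r1
          (HolAt.sum _ fun k => HolAt.smul (HolFunAt.const _ p) (hτ k)) ?_
        filter_upwards [r3, Filter.eventually_all.mpr hτΦ] with x e1 e2
        simp only [e1, e2, map_sum, map_smul, Finset.smul_sum]
        exact Finset.sum_congr rfl fun k _ => smul_comm _ _ _
      have : A w = ρ p := by
        rw [hρ, ← hw', map_sum]
        simp only [map_smul, hAb, hw']
      rw [this]; exact r2
    have hf0 : (frameMatrix F p τ p).charpoly.coeff (Module.finrank ℂ F - (j + 1)) = 0 := by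
      rw [← charpoly_eq_frameMatrix F p hbp A hAb, hA.charpoly_eq_X_pow_finrank, hfr,
        Polynomial.coeff_X_pow, if_neg (by omega)]
    obtain ⟨g, hg, hfg⟩ := (holFunAt_frameMatrix F p hτ _).exists_eq_coord_mul hf0
    refine ⟨g, hg, ?_⟩
    filter_upwards [nhdsWithin_le_nhds hfg, nhdsWithin_le_nhds hbase, coord_ne_zero p,
      Filter.eventually_all.mpr hτΦ] with x e1 e2 e3 e4
    have fdx := VectorBundle.finiteDimensional ℂ F E x
    rw [← charpoly_eq_frameMatrix F p e2 (coord p x • Φ x (v x)) (fun i => (e4 i).symm)] at e1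
    have e5 := charpoly_coeff_smul (coord p x) (Φ x (v x)) (j := j + 1) (by rw [hfr]; exact hj)
    rw [hfr] at e5
    rw [e5, pow_succ', mul_assoc] at e1
    exact (mul_left_cancel₀ e3 e1).symm

/-- The target of the Hitchin map: `⨁_{i=1}^m H⁰(X, K^{2i}(D^{2i-1}))`, the index of
the summand being `i - 1`. -/
abbrev hitchinBase (D : Finset X) (m : ℕ) : Type u :=
  ∀ i : Fin m, differentials D (2 * i + 2) (2 * i + 1)

/-- The Hitchin map `h_{E,st}`, sending `Φ` to `(s₂, s₄, …, s_{2m})`, where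
`det (t - Φ) = t^{2m} + s₂ t^{2m-2} + ⋯ + s_{2m}`. -/
def hitchinMap [∀ x, TopologicalSpace (L x)] [TopologicalSpace (TotalSpace ℂ L)] [FiberBundle ℂ L]
    {m : ℕ} (hm : Module.finrank ℂ F = 2 * m) (PE : ParabolicStructure D E)
    (φ : ∀ x, E x →ₗ[ℂ] E x →ₗ[ℂ] L x) (Φ : higgsFields F PE φ) : hitchinBase D m :=
  fun i => ⟨charCoeff F Φ.1 (2 * i + 2), charCoeff_mem F Φ.2 (2 * i + 1) (by omega)⟩

end Hitchin

/-! ### Polynomial maps of affine spaces as morphisms of schemes -/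

section Affine

variable (V W : Type u) [AddCommGroup V] [Module ℂ V] [AddCommGroup W] [Module ℂ W]

/-- The ring of polynomial functions on the complex vector space `V`. -/
def polyFun : Subalgebra ℂ (V → ℂ) :=
  Algebra.adjoin ℂ {f | ∃ l : V →ₗ[ℂ] ℂ, f = l}

/-- The affine space of the finite dimensional vector space `V`, as a scheme. -/
def affineSpace : Scheme.{u} := Spec (CommRingCat.of (polyFun V))

variable {V W}

/-- `f` is a polynomial map, i.e. a regular map of affine spaces. -/
def IsPolynomialMap (f : V → W) : Prop := ∀ g ∈ polyFun W, g ∘ f ∈ polyFun V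

/-- Pulling back polynomial functions along a polynomial map. -/
def IsPolynomialMap.pullback {f : V → W} (hf : IsPolynomialMap f) : polyFun W →+* polyFun V where
  toFun g := ⟨g.1 ∘ f, hf g.1 g.2⟩
  map_one' := rfl
  map_mul' _ _ := rfl
  map_zero' := rfl
  map_add' _ _ := rfl

/-- The morphism of schemes defined by a polynomial map. -/
def IsPolynomialMap.morphism {f : V → W} (hf : IsPolynomialMap f) :
    affineSpace V ⟶ affineSpace W :=
  Spec.map (CommRingCat.ofHom hf.pullback)

/-- A quasi-finite morphism: of finite type with finite fibres. -/
def IsQuasiFinite {Y Z : Scheme.{u}} (f : Y ⟶ Z) : Prop :=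
  LocallyOfFiniteType f ∧ QuasiCompact f ∧ ∀ z : Z, (f ⁻¹' {z}).Finite

end Affine

end ParabolicHiggs

end

/-! Each component s_{2i} of the Hitchin map is homogeneous of degree 2i in Φ, and the theorem comes
down to the zero fibre. A Φ over zero has vanishing even characteristic coefficients. The odd ones
vanish off D because the nondegenerate form makes A and -A have the same characteristic polynomial
(`charpoly_coeff_eq_zero_of_skew`). By Cayley–Hamilton the zero fibre is exactly the set of
nilpotent fields.

If that set is {0}, the Nullstellensatz puts a power of every coordinate into the ideal of the
components, and a graded Nakayama argument makes the polynomial functions on the source a finite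
module over those on the target (`exists_eq_top_of_zeroLocus`, `IsPolynomialMap.finite_pullback`).
Finite is the same as proper for a morphism of affine schemes, and a finite morphism has finite
fibres. Conversely, a nonzero nilpotent Φ spans a line of closed points in the fibre over 0, so that
fibre is infinite.

Two finiteness questions remain. The source is finite dimensional by a Schwarz lemma argument: on a
compact surface covered by finitely many discs, a field vanishing to high order at all centres is
forced to vanish (`finiteDimensional_of_norm_le`). For the target no dimension is computed:
polynomiality is evident for evaluation at a point and a tangent vector, and
`comp_mem_of_separating` extends it from these separating functionals to all linear ones. -/

namespace ParabolicHiggs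

/-! ### Finite dimensionality from the Schwarz lemma -/

section Schwarz

variable {V : Type*} [NormedAddCommGroup V] [NormedSpace ℂ V]

/-- **Schwarz lemma**: a bounded holomorphic function on a disc vanishing to order `k` at the
centre. -/
lemma norm_le_of_hasFPowerSeriesAt {G : ℂ → V} {c : ℂ} {R M : ℝ} {k : ℕ}
    {p : FormalMultilinearSeries ℂ ℂ V} (hd : DifferentiableOn ℂ G (Metric.ball c R))
    (hM : ∀ z ∈ Metric.ball c R, ‖G z‖ ≤ M) (hp : HasFPowerSeriesAt G p c)
    (hk : ∀ j ≤ k, p.coeff j = 0) {z : ℂ} (hz : z ∈ Metric.ball c R) :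
    ‖G z‖ ≤ M * (‖z - c‖ / R) ^ (k + 1) := by
  have h0 : G c = 0 := by
    rw [← hp.coeff_zero (fun _ => 1)]
    exact hk 0 (Nat.zero_le _)
  have hpz : p.partialSum (k + 1) = 0 := by
    funext y
    refine Finset.sum_eq_zero fun j hj => ?_
    rw [FormalMultilinearSeries.apply_eq_pow_smul_coeff, hk j (by simp at hj; omega), smul_zero]
  have hO := hp.isBigO_sub_partialSum_pow (k + 1)
  simp only [hpz, Pi.zero_apply, sub_zero] at hO
  -- Vanishing coefficients up to degree k give O(|w - c|^(k+1)), hence the o(|w - c|^k) required by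
  -- the higher order Schwarz lemma.
  have ho : (fun w => G w - G c) =o[𝓝 c] fun w => ‖w - c‖ ^ k := by
    have e : Filter.Tendsto (fun w => w - c) (𝓝 c) (𝓝 0) := by
      simpa using (continuous_sub_right c).tendsto c
    have h1 := hO.comp_tendsto e
    simp only [Function.comp_def, add_sub_cancel] at h1
    simp only [h0, sub_zero]
    refine h1.trans_isLittleO ?_
    have h2 : (fun y : ℂ => ‖y‖ ^ (k + 1)) =o[𝓝 0] fun y => ‖y‖ ^ k :=
      (Asymptotics.isLittleO_pow_pow (𝕜 := ℝ) (Nat.lt_succ_self k)).comp_tendsto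
        (by simpa using (continuous_norm (E := ℂ)).tendsto 0)
    exact h2.comp_tendsto e
  have := Complex.dist_le_mul_div_pow_of_mapsTo_ball_of_isLittleO (R₂ := M) hd
    (fun w hw => by simpa [h0] using hM w hw) ho hz
  simpa [h0, dist_eq_norm] using this

/-- A space of functions on finitely many discs, holomorphic up to removable singularities at
the centres, is finite dimensional if the values on the discs are controlled by the values on
smaller concentric discs. -/
theorem finiteDimensional_of_norm_le {W ι : Type*} [AddCommGroup W] [Module ℂ W] [Finite ι]
    [FiniteDimensional ℂ V] (f : ι → W →ₗ[ℂ] (ℂ → V)) (c : ι → ℂ) (r R : ι → ℝ) (S : ι → Set ℂ)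
    (hr : ∀ i, 0 < r i) (hrR : ∀ i, r i < R i) (hS : ∀ i, S i ⊆ {c i})
    (hol : ∀ i Φ, ∃ G : ℂ → V, DifferentiableOn ℂ G (Metric.ball (c i) (R i)) ∧
      ∀ z ∈ Metric.ball (c i) (R i), z ∉ S i → G z = f i Φ z)
    (C : ℝ) (hC : ∀ i, ∀ z ∈ Metric.ball (c i) (R i), z ∉ S i →
      ∃ j, ∃ w ∈ Metric.ball (c j) (r j), w ∉ S j ∧ ∀ Φ, ‖f i Φ z‖ ≤ C * ‖f j Φ w‖)
    (inj : ∀ Φ, (∀ i, ∀ z ∈ Metric.ball (c i) (r i), z ∉ S i → f i Φ z = 0) → Φ = 0) :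
    FiniteDimensional ℂ W := by
  classical
  have := Fintype.ofFinite ι
  wlog hC0 : 0 ≤ C generalizing C
  · refine this 0 (fun i z hz hzS => ?_) le_rfl
    obtain ⟨j, w, h1, h2, h3⟩ := hC i z hz hzS
    exact ⟨j, w, h1, h2, fun Φ => (h3 Φ).trans
      (mul_le_mul_of_nonneg_right (le_of_not_ge hC0) (norm_nonneg _))⟩
  choose G hGd hGf using hol
  have hR : ∀ i, 0 < R i := fun i => (hr i).trans (hrR i)
  have hGa : ∀ i Φ, AnalyticAt ℂ (G i Φ) (c i) := fun i Φ =>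
    (hGd i Φ).analyticAt (Metric.ball_mem_nhds _ (hR i))
  have hGe : ∀ i Φ, ∀ᶠ z in 𝓝[≠] c i, G i Φ z = f i Φ z := fun i Φ => by
    filter_upwards [nhdsWithin_le_nhds (Metric.ball_mem_nhds (c i) (hR i)), self_mem_nhdsWithin]
      with z h1 h2
    exact hGf i Φ z h1 fun h => h2 (hS i h)
  choose p hp using hGa
  -- `G i Φ` is chosen separately for each Φ, with no linearity built in. Its germ at the centre is
  -- determined by `f i Φ` on a punctured disc, so its Taylor series is linear in Φ.
  have hpa : ∀ i Φ Ψ, p i (Φ + Ψ) = p i Φ + p i Ψ := fun i Φ Ψ => by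
    refine (hp i _).eq_formalMultilinearSeries_of_eventually ((hp i Φ).add (hp i Ψ)) ?_
    refine ((hp i _).continuousAt.eventuallyEq_nhds_iff_eventuallyEq_nhdsNE
      ((hp i Φ).add (hp i Ψ)).continuousAt).mp ?_
    filter_upwards [hGe i Φ, hGe i Ψ, hGe i (Φ + Ψ)] with z h1 h2 h3
    simp [h1, h2, h3]
  have hps : ∀ i (a : ℂ) Φ, p i (a • Φ) = a • p i Φ := fun i a Φ => by
    refine (hp i _).eq_formalMultilinearSeries_of_eventually (hp i Φ).const_smul ?_
    refine ((hp i _).continuousAt.eventuallyEq_nhds_iff_eventuallyEq_nhdsNE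
      (hp i Φ).const_smul.continuousAt).mp ?_
    filter_upwards [hGe i Φ, hGe i (a • Φ)] with z h1 h2
    simp [h1, h2]
  -- The order k is so large that the Schwarz gain (r/R)^(k+1) beats the loss C incurred in passing
  -- from a large disc to a small one.
  obtain ⟨k, hk⟩ : ∃ k : ℕ, ∀ i, C * (r i / R i) ^ (k + 1) ≤ 1 / 2 := by
    have : ∀ i, ∀ᶠ k : ℕ in Filter.atTop, C * (r i / R i) ^ (k + 1) ≤ 1 / 2 := fun i => by
      have h1 := ((tendsto_pow_atTop_nhds_zero_of_lt_one (div_pos (hr i) (hR i)).le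
        ((div_lt_one (hR i)).mpr (hrR i))).comp (Filter.tendsto_add_atTop_nat 1)).const_mul C
      rw [mul_zero] at h1
      exact h1.eventually_le_const (by norm_num)
    exact (Filter.eventually_all.mpr this).exists
  -- The k-jets at the centres embed W: an element of the kernel is bounded on the small discs, and
  -- every bound there can be halved.
  let J : W →ₗ[ℂ] (ι → Fin (k + 1) → V) :=
    { toFun := fun Φ i j => (p i Φ).coeff j
      map_add' := fun Φ Ψ => by ext i j; simp only [hpa]; rfl
      map_smul' := fun a Φ => by ext i j; simp only [hps]; rfl }
  refine FiniteDimensional.of_injective J ((injective_iff_map_eq_zero J).mpr fun Φ hΦ => ?_)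
  have hcoeff : ∀ i, ∀ j ≤ k, (p i Φ).coeff j = 0 := fun i j hj =>
    congrFun (congrFun hΦ i) ⟨j, by omega⟩
  have hcont : ∀ i, ∃ M : ℝ, ∀ z ∈ Metric.ball (c i) (r i), ‖G i Φ z‖ ≤ M := fun i => by
    obtain ⟨M, hM⟩ := (isCompact_closedBall (c i) (r i)).exists_bound_of_continuousOn
      ((hGd i Φ).continuousOn.mono (Metric.closedBall_subset_ball (hrR i)))
    exact ⟨M, fun z hz => hM z (Metric.ball_subset_closedBall hz)⟩
  choose M hM using hcont
  have step : ∀ N : ℝ, 0 ≤ N →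
      (∀ i, ∀ z ∈ Metric.ball (c i) (r i), z ∉ S i → ‖f i Φ z‖ ≤ N) →
      ∀ i, ∀ z ∈ Metric.ball (c i) (r i), z ∉ S i → ‖f i Φ z‖ ≤ N / 2 := by
    intro N hN0 hN i z hz hzS
    have hz' := Metric.ball_subset_ball (hrR i).le hz
    have bd : ∀ w ∈ Metric.ball (c i) (R i), w ∉ S i → ‖G i Φ w‖ ≤ C * N := fun w hw hwS => by
      obtain ⟨j, w', h1, h2, h3⟩ := hC i w hw hwS
      rw [hGf i Φ w hw hwS]
      exact (h3 Φ).trans (mul_le_mul_of_nonneg_left (hN j w' h1 h2) hC0)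
    -- The bound extends to an exceptional centre by continuity.
    have bd' : ∀ w ∈ Metric.ball (c i) (R i), ‖G i Φ w‖ ≤ C * N := fun w hw => by
      by_cases hwS : w ∈ S i
      · have hwc : w = c i := hS i hwS
        subst hwc
        refine le_of_tendsto (x := 𝓝[≠] (c i)) ((hp i Φ).continuousAt.norm.tendsto.mono_left
          nhdsWithin_le_nhds) ?_
        filter_upwards [nhdsWithin_le_nhds (Metric.ball_mem_nhds (c i) (hR i)),
          self_mem_nhdsWithin] with v h1 h2
        exact bd v h1 fun h => h2 (hS i h)
      · exact bd w hw hwS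
    rw [← hGf i Φ z hz' hzS]
    calc ‖G i Φ z‖ ≤ C * N * (‖z - c i‖ / R i) ^ (k + 1) :=
          norm_le_of_hasFPowerSeriesAt (hGd i Φ) bd' (hp i Φ) (hcoeff i) hz'
      _ ≤ C * N * (r i / R i) ^ (k + 1) := by
          have : ‖z - c i‖ ≤ r i := by
            rw [← dist_eq_norm]; exact (Metric.mem_ball.mp hz).le
          have := (hR i).le
          gcongr
      _ = N * (C * (r i / R i) ^ (k + 1)) := by ring
      _ ≤ N * (1 / 2) := mul_le_mul_of_nonneg_left (hk i) hN0
      _ = N / 2 := by ring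
  obtain ⟨N, hN0, hN⟩ : ∃ N : ℝ, 0 ≤ N ∧ ∀ i, M i ≤ N :=
    ⟨∑ i, |M i|, Finset.sum_nonneg fun _ _ => abs_nonneg _, fun i => (le_abs_self _).trans
      (Finset.single_le_sum (f := fun i => |M i|) (fun _ _ => abs_nonneg _) (Finset.mem_univ i))⟩
  have all : ∀ n : ℕ, ∀ i, ∀ z ∈ Metric.ball (c i) (r i), z ∉ S i →
      ‖f i Φ z‖ ≤ N * (1 / 2) ^ n := by
    intro n
    induction n with
    | zero =>
      intro i z hz hzS
      rw [← hGf i Φ z (Metric.ball_subset_ball (hrR i).le hz) hzS, pow_zero, mul_one]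
      exact (hM i z hz).trans (hN i)
    | succ n ih =>
      intro i z hz hzS
      exact (step _ (by positivity) ih i z hz hzS).trans_eq (by ring)
  refine inj Φ fun i z hz hzS => norm_le_zero_iff.mp ?_
  have ht := (tendsto_pow_atTop_nhds_zero_of_lt_one (r := (1 / 2 : ℝ)) (by norm_num)
    (by norm_num)).const_mul N
  rw [mul_zero] at ht
  exact ge_of_tendsto' ht fun n => all n i z hz hzS

end Schwarz

/-! ### Finite dimensionality over a compact Riemann surface -/

section Finiteness

variable {X : Type u} [TopologicalSpace X] [ChartedSpace ℂ X] [IsManifold 𝓘(ℂ) ω X]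

lemma differentiableAt_comp_chart_symm {V : Type*} [NormedAddCommGroup V] [NormedSpace ℂ V]
    {f : X → V} (p : X) {z : ℂ} (hz : z ∈ (chartAt ℂ p).target)
    (hf : ContMDiffAt 𝓘(ℂ) 𝓘(ℂ, V) ω f ((chartAt ℂ p).symm z)) :
    DifferentiableAt ℂ (f ∘ (chartAt ℂ p).symm) z := by
  have h1 : ContMDiffAt 𝓘(ℂ) 𝓘(ℂ) ω (chartAt ℂ p).symm z :=
    (contMDiffOn_chart_symm (I := 𝓘(ℂ)) (n := ω) (x := p)).contMDiffAt
      ((chartAt ℂ p).open_target.mem_nhds hz)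
  exact (hf.comp z h1).contDiffAt.differentiableAt (by simp)

/-- Finite dimensionality of a space of functions which are holomorphic on the members `U p` of an
open cover, up to removable singularities at the points of `D`, and whose values for different
members of the cover are comparable. -/
theorem finiteDimensional_of_comparable [T2Space X] [CompactSpace X] {V W : Type*}
    [NormedAddCommGroup V] [NormedSpace ℂ V] [FiniteDimensional ℂ V]
    [AddCommGroup W] [Module ℂ W] (D : Finset X) (U : X → Set X) (hU : ∀ p, IsOpen (U p))
    (hpU : ∀ p, p ∈ U p) (hUD : ∀ p, ∀ x ∈ U p, x ∈ D → x = p) (a : X → W →ₗ[ℂ] (X → V))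
    (hol : ∀ p Φ, ∀ x ∈ U p, x ∉ D → ContMDiffAt 𝓘(ℂ) 𝓘(ℂ, V) ω (a p Φ) x)
    (ext : ∀ p ∈ D, ∀ Φ, ∃ g, ContMDiffAt 𝓘(ℂ) 𝓘(ℂ, V) ω g p ∧ ∀ᶠ x in 𝓝[≠] p, g x = a p Φ x)
    (comp : ∀ p q x, x ∈ U p → x ∈ U q → ∃ C : ℝ, ∀ᶠ y in 𝓝 x, y ∉ D →
      ∀ Φ, ‖a p Φ y‖ ≤ C * ‖a q Φ y‖)
    (inj : ∀ Φ, (∀ p, ∀ᶠ x in 𝓝 p, x ∉ D → a p Φ x = 0) → Φ = 0) :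
    FiniteDimensional ℂ W := by
  classical
  have hrad : ∀ p : X, ∃ ρ : ℝ, 0 < ρ ∧ ∀ z ∈ Metric.closedBall (chartAt ℂ p p) ρ,
      z ∈ (chartAt ℂ p).target ∧ (chartAt ℂ p).symm z ∈ U p := fun p => by
    have h1 : ∀ᶠ z in 𝓝 (chartAt ℂ p p), z ∈ (chartAt ℂ p).target ∧ (chartAt ℂ p).symm z ∈ U p :=
      Filter.Eventually.and ((chartAt ℂ p).open_target.mem_nhds (mem_chart_target ℂ p))
        (((chartAt ℂ p).continuousAt_symm (mem_chart_target ℂ p)).eventually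
          (by simpa using (hU p).mem_nhds (hpU p)))
    obtain ⟨ρ, h2, h3⟩ := Metric.nhds_basis_closedBall.mem_iff.mp h1
    exact ⟨ρ, h2, h3⟩
  choose ρ hρ hρt hρU using hrad
  -- The half-radius discs already cover X; the full discs leave the room that the Schwarz lemma
  -- needs.
  set O : X → Set X := fun p =>
    (chartAt ℂ p).source ∩ chartAt ℂ p ⁻¹' Metric.ball (chartAt ℂ p p) (ρ p / 2) with hO
  have hOo : ∀ p, O p ∈ 𝓝 p := fun p =>
    ((chartAt ℂ p).isOpen_inter_preimage Metric.isOpen_ball).mem_nhds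
      ⟨mem_chart_source ℂ p, Metric.mem_ball_self (by have := hρ p; positivity)⟩
  obtain ⟨t, -, ht⟩ := isCompact_univ.elim_nhds_subcover O fun p _ => hOo p
  set K : X → Set X := fun p => (chartAt ℂ p).symm '' Metric.closedBall (chartAt ℂ p p) (ρ p)
    with hK
  have hKc : ∀ p, IsCompact (K p) := fun p => (isCompact_closedBall _ _).image_of_continuousOn
    ((chartAt ℂ p).continuousOn_symm.mono fun z hz => hρt p z hz)
  have hKU : ∀ p, K p ⊆ U p := by
    rintro p _ ⟨z, hz, rfl⟩
    exact hρU p z hz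
  have hOK : ∀ p, O p ⊆ K p := fun p x hx =>
    ⟨chartAt ℂ p x, Metric.ball_subset_closedBall (Metric.ball_subset_ball
      (by have := hρ p; linarith) hx.2), (chartAt ℂ p).left_inv hx.1⟩
  -- Local comparability becomes uniform on the compact set `K p ∩ K q`, two constants being merged
  -- by their maximum.
  have hcomp : ∀ pq : t × t, ∃ C : ℝ, ∀ y ∈ K pq.1 ∩ K pq.2, y ∉ D →
      ∀ Φ, ‖a pq.1 Φ y‖ ≤ C * ‖a pq.2 Φ y‖ := by
    rintro ⟨p, q⟩
    refine ((hKc p).inter (hKc q)).induction_on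
      (p := fun s => ∃ C : ℝ, ∀ y ∈ s, y ∉ D → ∀ Φ, ‖a p Φ y‖ ≤ C * ‖a q Φ y‖)
      ⟨0, by simp⟩ ?_ ?_ ?_
    · rintro s s' hs ⟨C, hC⟩
      exact ⟨C, fun y hy => hC y (hs hy)⟩
    · rintro s s' ⟨C, hC⟩ ⟨C', hC'⟩
      refine ⟨max C C', ?_⟩
      rintro y (hy | hy) hyD Φ
      · exact (hC y hy hyD Φ).trans
          (mul_le_mul_of_nonneg_right (le_max_left _ _) (norm_nonneg _))
      · exact (hC' y hy hyD Φ).trans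
          (mul_le_mul_of_nonneg_right (le_max_right _ _) (norm_nonneg _))
    · intro x hx
      obtain ⟨C, hC⟩ := comp p q x (hKU p hx.1) (hKU q hx.2)
      exact ⟨_, nhdsWithin_le_nhds hC, C, fun y hy => hy⟩
  choose C hC using hcomp
  obtain ⟨B, hB⟩ := Finite.exists_le C
  have hDc : ∀ p, ∀ z ∈ Metric.closedBall (chartAt ℂ p p) (ρ p),
      z ∉ {w | w = chartAt ℂ p p ∧ p ∈ D} → (chartAt ℂ p).symm z ∉ D := fun p z hz hzS hD => by
    have h1 := hUD p _ (hρU p z hz) hD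
    refine hzS ⟨?_, h1 ▸ hD⟩
    rw [← (chartAt ℂ p).right_inv (hρt p z hz), h1]
  refine finiteDimensional_of_norm_le (ι := t) (V := V)
    (fun p => (LinearMap.funLeft ℂ V (chartAt ℂ p.1).symm).comp (a p))
    (fun p => chartAt ℂ p.1 p.1) (fun p => ρ p / 2) (fun p => ρ p)
    (fun p => {w | w = chartAt ℂ p.1 p.1 ∧ p.1 ∈ D})
    (fun p => by have := hρ p; positivity) (fun p => by have := hρ p; linarith)
    (fun p z hz => hz.1) ?_ B ?_ ?_
  · rintro ⟨p, hp⟩ Φ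
    have hd : ∀ z ∈ Metric.ball (chartAt ℂ p p) (ρ p), (chartAt ℂ p).symm z ∉ D →
        DifferentiableAt ℂ (a p Φ ∘ (chartAt ℂ p).symm) z := fun z hz hzD =>
      have hz' := Metric.ball_subset_closedBall hz
      differentiableAt_comp_chart_symm p (hρt p z hz') (hol p Φ _ (hρU p z hz') hzD)
    by_cases hpD : p ∈ D
    · obtain ⟨g, hg, hga⟩ := ext p hpD Φ
      -- The singularity is removed by correcting the single value at the centre.
      set G : ℂ → V := Function.update (a p Φ ∘ (chartAt ℂ p).symm) (chartAt ℂ p p) (g p) with hG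
      have hGne : ∀ z, z ≠ chartAt ℂ p p → G z = (a p Φ ∘ (chartAt ℂ p).symm) z := fun z hz =>
        Function.update_of_ne hz _ _
      refine ⟨G, fun z hz => DifferentiableAt.differentiableWithinAt ?_, fun z hz hzS => ?_⟩
      · have hz' := Metric.ball_subset_closedBall hz
        by_cases hzc : z = chartAt ℂ p p
        · subst hzc
          refine (differentiableAt_comp_chart_symm p (mem_chart_target ℂ p)
            (f := g) (by simpa using hg)).congr_of_eventuallyEq ?_
          have h1 : ∀ᶠ z in 𝓝 (chartAt ℂ p p), (chartAt ℂ p).symm z ≠ p →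
              g ((chartAt ℂ p).symm z) = a p Φ ((chartAt ℂ p).symm z) :=
            ((chartAt ℂ p).continuousAt_symm (mem_chart_target ℂ p)).eventually
              (by simpa using eventually_nhdsWithin_iff.mp hga)
          filter_upwards [h1, (chartAt ℂ p).open_target.mem_nhds (mem_chart_target ℂ p)]
            with w hw hwt
          by_cases hwc : w = chartAt ℂ p p
          · subst hwc
            simp [hG]
          · rw [hGne w hwc]
            refine (hw fun h => hwc ?_).symm
            rw [← (chartAt ℂ p).right_inv hwt, h]
        · refine (hd z hz (hDc p z hz' fun h => hzc h.1)).congr_of_eventuallyEq ?_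
          filter_upwards [isOpen_ne.mem_nhds hzc] with w hw using hGne w hw
      · exact hGne z fun h => hzS ⟨h, hpD⟩
    · refine ⟨a p Φ ∘ (chartAt ℂ p).symm, fun z hz => DifferentiableAt.differentiableWithinAt
        (hd z hz (hDc p z (Metric.ball_subset_closedBall hz) fun h => hpD h.2)), fun z hz _ => rfl⟩
  · rintro p z hz hzS
    have hz' := Metric.ball_subset_closedBall hz
    have hD := hDc p z hz' hzS
    obtain ⟨q, hq, hzq⟩ := Set.mem_iUnion₂.mp (ht (Set.mem_univ ((chartAt ℂ p.1).symm z)))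
    have hl := (chartAt ℂ q).left_inv hzq.1
    refine ⟨⟨q, hq⟩, chartAt ℂ q ((chartAt ℂ p.1).symm z), hzq.2, fun h => hD ?_, fun Φ => ?_⟩
    · have h1 := h.1
      dsimp only at h1
      rw [← hl, h1]
      simpa using h.2
    · have h1 := hC (p, ⟨q, hq⟩) ((chartAt ℂ p.1).symm z) ⟨⟨z, hz', rfl⟩, hOK q hzq⟩ hD Φ
      simp only [LinearMap.comp_apply, LinearMap.funLeft_apply, hl]
      exact h1.trans (mul_le_mul_of_nonneg_right (hB _) (norm_nonneg _))
  · intro Φ hΦ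
    have h0 : ∀ q ∈ t, ∀ x ∈ O q, x ∉ D → a q Φ x = 0 := fun q hq x hx hxD => by
      have hl := (chartAt ℂ q).left_inv hx.1
      have := hΦ ⟨q, hq⟩ (chartAt ℂ q x) hx.2 fun h => hxD (by
        have h1 := h.1
        dsimp only at h1
        rw [← hl, h1]
        simpa using h.2)
      simpa [LinearMap.funLeft_apply, hl] using this
    refine inj Φ fun p => ?_
    have hev : ∀ᶠ x in 𝓝 p, x ∈ U p := (hU p).mem_nhds (hpU p)
    filter_upwards [hev] with x hx hxD
    obtain ⟨q, hq, hxq⟩ := Set.mem_iUnion₂.mp (ht (Set.mem_univ x))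
    obtain ⟨C', hC'⟩ := comp p q x hx (hKU q (hOK q hxq))
    have h1 := hC'.self_of_nhds hxD Φ
    rw [h0 q hq x hxq hxD, norm_zero, mul_zero] at h1
    exact norm_le_zero_iff.mp h1

end Finiteness

lemma coord_ne_zero_of_mem_source {X : Type u} [TopologicalSpace X] [ChartedSpace ℂ X] {p x : X}
    (hx : x ∈ (chartAt ℂ p).source) (hne : x ≠ p) : coord p x ≠ 0 := fun h0 =>
  hne ((chartAt ℂ p).injOn hx (mem_chart_source ℂ p) (sub_eq_zero.mp h0))

/-! ### Local frames of holomorphic bundles -/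

section Frames

variable {X : Type u} [TopologicalSpace X] [ChartedSpace ℂ X]
variable (F : Type*) [NormedAddCommGroup F] [NormedSpace ℂ F] [FiniteDimensional ℂ F]
    (E : X → Type*)
    [∀ x, TopologicalSpace (E x)] [TopologicalSpace (TotalSpace F E)] [FiberBundle F E]
    [∀ x, AddCommGroup (E x)] [∀ x, Module ℂ (E x)] [VectorBundle ℂ F E]
    [ContMDiffVectorBundle ω F E 𝓘(ℂ)]

/-- A holomorphic vector bundle has local frames with holomorphic coefficient functionals. -/
lemma exists_localFrame {ι : Type*} [Fintype ι] (b : Module.Basis ι ℂ F) (p : X) :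
    ∃ (U : Set X) (s : ι → ∀ x, E x) (κ : ι → ∀ x, E x →ₗ[ℂ] ℂ), IsOpen U ∧ p ∈ U ∧
      (∀ x ∈ U, ∀ i, HolAt F (s i) x) ∧
      (∀ x ∈ U, ∀ σ : ∀ x, E x, HolAt F σ x → ∀ i, HolFunAt (fun y => κ i y (σ y)) x) ∧
      ∀ x ∈ U, ∀ w, w = ∑ i, κ i x w • s i x := by
  classical
  have : ContMDiffVectorBundle 1 F E 𝓘(ℂ) := .of_le (n := ω) le_top
  set e := trivializationAt F E p
  refine ⟨e.baseSet, e.localFrame b, e.localFrameCoeff 𝓘(ℂ) b, e.open_baseSet,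
    FiberBundle.mem_baseSet_trivializationAt F E p, fun x hx i => ?_, fun x hx σ hσ i => ?_,
    fun x hx w => ?_⟩
  · exact contMDiffAt_localFrame_of_mem ω _ _ i hx
  · exact contMDiffAt_localFrameCoeff b hx hσ i
  -- The frame expansion is stated for sections but is pointwise, so w may be extended by zero away
  -- from x.
  · have h := (e.isLocalFrameOn_localFrame_baseSet 𝓘(ℂ) 1 b).coeff_sum_eq
      (fun y => if h : y = x then h ▸ w else 0) hx
    simpa [Bundle.Trivialization.localFrameCoeff] using h

end Frames

/-! ### Finite dimensionality of the space of Higgs fields -/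

section HiggsFiniteness

variable {X : Type u} [TopologicalSpace X] [ChartedSpace ℂ X] [IsManifold 𝓘(ℂ) ω X] {D : Finset X}
variable (F : Type*) [NormedAddCommGroup F] [NormedSpace ℂ F] [FiniteDimensional ℂ F]
    {E : X → Type*}
    [∀ x, TopologicalSpace (E x)] [TopologicalSpace (TotalSpace F E)] [FiberBundle F E]
    [∀ x, AddCommGroup (E x)] [∀ x, Module ℂ (E x)] [VectorBundle ℂ F E]
    [ContMDiffVectorBundle ω F E 𝓘(ℂ)]
    {L : X → Type*} [∀ x, AddCommGroup (L x)] [∀ x, Module ℂ (L x)]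

lemma holFunAt_coord_of_mem_source (p : X) {x : X} (hx : x ∈ (chartAt ℂ p).source) :
    HolFunAt (coord p) x := by
  have h := contMDiffAt_of_mem_maximalAtlas (I := 𝓘(ℂ)) (n := ω)
    (IsManifold.chart_mem_maximalAtlas (I := 𝓘(ℂ)) (n := ω) p) hx
  exact ContMDiffAt.sub h contMDiffAt_const

/-- Change of frame for the matrix entries of a family of endomorphisms parametrised by a line. -/
lemma norm_matrix_le {V T₀ ι : Type*} [AddCommGroup V] [Module ℂ V] [AddCommGroup T₀] [Module ℂ T₀]
    [Fintype ι] (A : T₀ →ₗ[ℂ] Module.End ℂ V) {s s' : ι → V} {κ κ' : ι → V →ₗ[ℂ] ℂ} {v v' : T₀}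
    {η η' d : ℂ} (hs' : ∀ w, w = ∑ i, κ' i w • s' i) (hv : v = d • v') (hη' : η' ≠ 0) :
    ‖(fun i j => η * κ i (A v (s j)) : ι → ι → ℂ)‖ ≤
      (‖η‖ * ‖η'⁻¹‖ * ‖d‖ * ∑ i, ∑ j, ∑ k, ∑ l, ‖κ' k (s j)‖ * ‖κ i (s' l)‖) *
        ‖(fun i j => η' * κ' i (A v' (s' j)) : ι → ι → ℂ)‖ := by
  set N := ‖(fun i j => η' * κ' i (A v' (s' j)) : ι → ι → ℂ)‖ with hN
  have hN0 : 0 ≤ N := norm_nonneg _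
  refine (pi_norm_le_iff_of_nonneg (by positivity)).mpr fun i =>
    (pi_norm_le_iff_of_nonneg (by positivity)).mpr fun j => ?_
  have hent : ∀ k l, ‖κ' l (A v' (s' k))‖ ≤ ‖η'⁻¹‖ * N := fun k l => by
    have h1 : ‖η' * κ' l (A v' (s' k))‖ ≤ N :=
      (norm_le_pi_norm ((fun i j => η' * κ' i (A v' (s' j)) : ι → ι → ℂ) l) k).trans
        (norm_le_pi_norm (fun i j => η' * κ' i (A v' (s' j)) : ι → ι → ℂ) l)
    calc ‖κ' l (A v' (s' k))‖ = ‖η'⁻¹‖ * ‖η' * κ' l (A v' (s' k))‖ := by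
          rw [← norm_mul, inv_mul_cancel_left₀ hη']
      _ ≤ _ := mul_le_mul_of_nonneg_left h1 (norm_nonneg _)
  -- The two matrices differ by transition matrices on both sides and by scalars, so the constant
  -- depends on the frames but not on A.
  have e1 : κ i (A v (s j)) =
      d * ∑ k, ∑ l, κ' k (s j) * (κ' l (A v' (s' k)) * κ i (s' l)) := by
    have h2 : A v' (s j) = ∑ k, κ' k (s j) • A v' (s' k) := by
      conv_lhs => rw [hs' (s j)]
      simp
    have h3 : ∀ k, κ i (A v' (s' k)) = ∑ l, κ' l (A v' (s' k)) * κ i (s' l) := fun k => by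
      conv_lhs => rw [hs' (A v' (s' k))]
      simp
    rw [hv, map_smul, LinearMap.smul_apply, map_smul, h2, map_sum, smul_eq_mul]
    congr 1
    refine Finset.sum_congr rfl fun k _ => ?_
    rw [map_smul, h3, smul_eq_mul, Finset.mul_sum]
  have e2 : ‖∑ k, ∑ l, κ' k (s j) * (κ' l (A v' (s' k)) * κ i (s' l))‖ ≤
      (‖η'⁻¹‖ * N) * ∑ k, ∑ l, ‖κ' k (s j)‖ * ‖κ i (s' l)‖ := by
    rw [Finset.mul_sum]
    refine norm_sum_le_of_le _ fun k _ => ?_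
    rw [Finset.mul_sum]
    refine norm_sum_le_of_le _ fun l _ => ?_
    rw [norm_mul, norm_mul]
    calc ‖κ' k (s j)‖ * (‖κ' l (A v' (s' k))‖ * ‖κ i (s' l)‖)
        ≤ ‖κ' k (s j)‖ * ((‖η'⁻¹‖ * N) * ‖κ i (s' l)‖) := by
          have := hent k l
          gcongr
      _ = _ := by ring
  have e3 : ∑ k, ∑ l, ‖κ' k (s j)‖ * ‖κ i (s' l)‖ ≤
      ∑ i, ∑ j, ∑ k, ∑ l, ‖κ' k (s j)‖ * ‖κ i (s' l)‖ :=
    (Finset.single_le_sum (f := fun j => ∑ k, ∑ l, ‖κ' k (s j)‖ * ‖κ i (s' l)‖)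
      (fun _ _ => by positivity) (Finset.mem_univ j)).trans
    (Finset.single_le_sum (f := fun i => ∑ j, ∑ k, ∑ l, ‖κ' k (s j)‖ * ‖κ i (s' l)‖)
      (fun _ _ => by positivity) (Finset.mem_univ i))
  calc ‖η * κ i (A v (s j))‖
      = ‖η‖ * (‖d‖ * ‖∑ k, ∑ l, κ' k (s j) * (κ' l (A v' (s' k)) * κ i (s' l))‖) := by
        rw [e1, norm_mul, norm_mul]
    _ ≤ ‖η‖ * (‖d‖ * ((‖η'⁻¹‖ * N) *
          ∑ i, ∑ j, ∑ k, ∑ l, ‖κ' k (s j)‖ * ‖κ i (s' l)‖)) := by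
        have := e2.trans (mul_le_mul_of_nonneg_left e3 (by positivity))
        gcongr
    _ = _ := by ring

/-- The space of strongly parabolic symplectic Higgs fields is finite dimensional. -/
theorem finiteDimensional_higgsFields [T2Space X] [CompactSpace X] (PE : ParabolicStructure D E)
    (φ : ∀ x, E x →ₗ[ℂ] E x →ₗ[ℂ] L x) : FiniteDimensional ℂ (higgsFields F PE φ) := by
  classical
  choose U₁ s κ hU₁ hpU₁ hs hκ hsκ using exists_localFrame F E (Module.finBasis ℂ F)
  choose U₂ v d hU₂ hpU₂ hv hd hvd using exists_localFrame ℂ (fun x : X => T x)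
    (Module.Basis.singleton Unit ℂ)
  -- Multiplication by the coordinate clears the simple pole at a parabolic point.
  let η : X → X → ℂ := fun p x => if p ∈ D then coord p x else 1
  -- Removing `D.erase p` leaves p as the only possible parabolic point of `U p`.
  let U : X → Set X := fun p => (chartAt ℂ p).source ∩ (U₁ p ∩ (U₂ p ∩ (↑(D.erase p))ᶜ))
  have hUD : ∀ p, ∀ x ∈ U p, x ∈ D → x = p := fun p x hx hxD => by
    by_contra hne
    exact hx.2.2.2 (by simp [hne, hxD])
  have hη : ∀ p, ∀ x ∈ U p, HolFunAt (η p) x := fun p x hx => by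
    by_cases hp : p ∈ D
    · simpa only [η, hp, if_true] using holFunAt_coord_of_mem_source p hx.1
    · simpa only [η, hp, if_false] using HolFunAt.const 1 x
  have hη0 : ∀ p, ∀ x ∈ U p, x ∉ D → η p x ≠ 0 := fun p x hx hxD => by
    by_cases hp : p ∈ D
    · simpa only [η, hp, if_true] using
        coord_ne_zero_of_mem_source hx.1 fun h => hxD (h ▸ hp)
    · simp [η, hp]
  let n := Module.finrank ℂ F
  let a : X → higgsFields F PE φ →ₗ[ℂ] (X → Fin n → Fin n → ℂ) := fun p =>
    { toFun := fun Φ x i j => η p x * κ p i x (Φ.1 x (v p () x) (s p j x))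
      map_add' := fun Φ Ψ => by
        ext x i j
        simp [mul_add]
      map_smul' := fun c Φ => by
        ext x i j
        simp [mul_left_comm] }
  have ha : ∀ p Φ x, a p Φ x = fun i j => η p x * κ p i x (Φ.1 x (v p () x) (s p j x)) :=
    fun _ _ _ => rfl
  refine finiteDimensional_of_comparable D U (fun p => ?_) (fun p => ?_) hUD a ?_ ?_ ?_ ?_
  · exact (chartAt ℂ p).open_source.inter ((hU₁ p).inter ((hU₂ p).inter
      (Finset.finite_toSet _).isClosed.isOpen_compl))
  · exact ⟨mem_chart_source ℂ p, hpU₁ p, hpU₂ p, by simp⟩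
  · intro p Φ x hx hxD
    refine contMDiffAt_pi_space.mpr fun i => contMDiffAt_pi_space.mpr fun j => ?_
    exact (hη p x hx).mul (hκ p x hx.2.1 _ (Φ.2.2.1 x hxD _ _ (hv p x hx.2.2.1 ())
      (hs p x hx.2.1 j)) i)
  · intro p hp Φ
    by_cases hlen : 0 < (PE ⟨p, hp⟩).len
    -- The top step of the flag is all of E_p, so the parabolic condition there extends `coord p •
    -- Φ` holomorphically on the whole frame.
    · choose τ hτ _ hτΦ using fun j => Φ.2.2.2.1 ⟨p, hp⟩ _ _ (hv p p (hpU₂ p) ())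
        (hs p p (hpU₁ p) j) ⟨0, hlen⟩ (by
          have : (PE ⟨p, hp⟩).flag (Fin.castSucc ⟨0, hlen⟩) = ⊤ := (PE ⟨p, hp⟩).flag_zero
          rw [this]; trivial)
      refine ⟨fun x i j => κ p i x (τ j x), contMDiffAt_pi_space.mpr fun i =>
        contMDiffAt_pi_space.mpr fun j => hκ p p (hpU₁ p) _ (hτ j) i, ?_⟩
      filter_upwards [Filter.eventually_all.mpr hτΦ] with x hx
      rw [ha]
      funext i j
      simp [hx, η, hp]
    -- A flag of length zero forces E_p = 0; the rank is then 0 and the matrices are empty.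
    · have h0' : (0 : Fin ((PE ⟨p, hp⟩).len + 1)) = Fin.last _ := Fin.ext (by simp; omega)
      have htop := (PE ⟨p, hp⟩).flag_zero
      rw [h0', (PE ⟨p, hp⟩).flag_last] at htop
      have h3 := finrank_top ℂ (E p)
      have hfr : Module.finrank ℂ (E p) = n := VectorBundle.finrank_eq ℂ F E p
      rw [← htop, finrank_bot, hfr] at h3
      exact ⟨fun _ => 0, contMDiffAt_const, Filter.Eventually.of_forall fun x =>
        funext fun i => absurd i.2 (by omega)⟩
  · intro p q x hxp hxq
    -- At a parabolic point p and q must coincide. Elsewhere both factors η are nonzero and the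
    -- transition data are continuous, hence locally bounded.
    by_cases hxD : x ∈ D
    · obtain rfl := hUD p x hxp hxD
      obtain rfl := hUD q x hxq hxD
      exact ⟨1, Filter.Eventually.of_forall fun y _ Φ => (one_mul _).ge⟩
    · have hdc : ContinuousAt (fun y => d q () y (v p () y)) x :=
        ContMDiffAt.continuousAt (hd q x hxq.2.2.1 _ (hv p x hxp.2.2.1 ()) ())
      have hκq : ∀ k j, ContinuousAt (fun y => κ q k y (s p j y)) x := fun k j =>
        ContMDiffAt.continuousAt (hκ q x hxq.2.1 _ (hs p x hxp.2.1 j) k)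
      have hκp : ∀ i l, ContinuousAt (fun y => κ p i y (s q l y)) x := fun i l =>
        ContMDiffAt.continuousAt (hκ p x hxp.2.1 _ (hs q x hxq.2.1 l) i)
      have hηp : ContinuousAt (η p) x := ContMDiffAt.continuousAt (hη p x hxp)
      have hηq : ContinuousAt (η q) x := ContMDiffAt.continuousAt (hη q x hxq)
      let B : X → ℝ := fun y => ‖η p y‖ * ‖(η q y)⁻¹‖ * ‖d q () y (v p () y)‖ *
        ∑ i, ∑ j, ∑ k, ∑ l, ‖κ q k y (s p j y)‖ * ‖κ p i y (s q l y)‖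
      have hB : ContinuousAt B x := by
        refine ((hηp.norm.mul (hηq.inv₀ (hη0 q x hxq hxD)).norm).mul hdc.norm).mul ?_
        exact tendsto_finsetSum _ fun i _ => tendsto_finsetSum _ fun j _ =>
          tendsto_finsetSum _ fun k _ => tendsto_finsetSum _ fun l _ =>
            (hκq k j).norm.mul (hκp i l).norm
      have hUq : ∀ᶠ y in 𝓝 x, y ∈ U q :=
        ((chartAt ℂ q).open_source.inter ((hU₁ q).inter ((hU₂ q).inter
          (Finset.finite_toSet _).isClosed.isOpen_compl))).mem_nhds hxq
      refine ⟨B x + 1, ?_⟩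
      filter_upwards [hUq, hB.eventually_le_const (lt_add_one (B x))] with y hy hBy hyD Φ
      refine (norm_matrix_le (Φ.1 y) (hsκ q y hy.2.1) (d := d q () y (v p () y))
        (v' := v q () y) ?_ (hη0 q y hy hyD)).trans
        (mul_le_mul_of_nonneg_right hBy (norm_nonneg _))
      simpa using hvd q y hy.2.2.1 (v p () y)
  · intro Φ hΦ
    refine Subtype.ext (funext fun x => ?_)
    by_cases hxD : x ∈ D
    · exact Φ.2.1 x hxD
    · have h1 := (hΦ x).self_of_nhds hxD
      have h2 : ∀ i j, κ x i x (Φ.1 x (v x () x) (s x j x)) = 0 := fun i j => by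
        have := congrFun (congrFun h1 i) j
        rw [ha] at this
        simpa [η, hxD] using this
      have h3 : Φ.1 x (v x () x) = 0 := LinearMap.ext fun w => by
        rw [hsκ x x (hpU₁ x) w, map_sum]
        simp only [map_smul]
        refine Finset.sum_eq_zero fun j _ => ?_
        rw [hsκ x x (hpU₁ x) (Φ.1 x (v x () x) (s x j x))]
        simp [h2]
      refine LinearMap.ext fun u => ?_
      rw [hvd x x (hpU₂ x) u]
      simp [h3]

end HiggsFiniteness

/-! ### Separating functionals and skew endomorphisms -/

section LinearAlgebra

/-- If a map `H` into a space with a separating family of functionals has all its components in a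
finite dimensional space of functions, then every functional composed with `H` lies there. -/
lemma comp_mem_of_separating {S M Y : Type*} [AddCommGroup M] [Module ℂ M]
    (P : Submodule ℂ (S → ℂ)) [FiniteDimensional ℂ P] (ev : Y → Module.Dual ℂ M)
    (hsep : ∀ m, (∀ y, ev y m = 0) → m = 0) (H : S → M) (hH : ∀ y, (fun s => ev y (H s)) ∈ P)
    (l : Module.Dual ℂ M) : (fun s => l (H s)) ∈ P := by
  set A₁ : (S →₀ ℂ) →ₗ[ℂ] M := Finsupp.linearCombination ℂ H with hA₁
  set A₂ : (S →₀ ℂ) →ₗ[ℂ] Module.Dual ℂ P := Finsupp.linearCombination ℂ fun s =>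
    (LinearMap.proj s : (S → ℂ) →ₗ[ℂ] ℂ).comp P.subtype with hA₂
  -- A formal combination of points of S that kills P is sent to 0 in M, because the functions `ev y
  -- ∘ H` lie in P and the `ev y` separate M. Hence `l ∘ A₁` factors through `A₂` by a functional on
  -- the dual of P, which by reflexivity is an element of P.
  have hker : l.comp A₁ ∈ (LinearMap.ker A₂).dualAnnihilator := by
    rw [Submodule.mem_dualAnnihilator]
    intro ξ hξ
    suffices h : A₁ ξ = 0 by simp [h]
    refine hsep _ fun y => ?_
    have h1 := LinearMap.congr_fun (LinearMap.mem_ker.mp hξ) ⟨_, hH y⟩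
    simpa [hA₁, hA₂, Finsupp.linearCombination_apply, Finsupp.sum, LinearMap.sum_apply]
      using h1
  rw [← LinearMap.range_dualMap_eq_dualAnnihilator_ker] at hker
  obtain ⟨Λ, hΛ⟩ := hker
  convert ((Module.evalEquiv ℂ P).symm Λ).2 using 1
  funext s
  have h1 := LinearMap.congr_fun hΛ (Finsupp.single s 1)
  have h2 := Module.apply_evalEquiv_symm_apply ℂ P
    ((LinearMap.proj s : (S → ℂ) →ₗ[ℂ] ℂ).comp P.subtype) Λ
  simp only [LinearMap.comp_apply, Submodule.subtype_apply, LinearMap.proj_apply] at h2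
  rw [h2]
  simpa [hA₁, hA₂] using h1.symm

lemma charpoly_dualMap {V : Type*} [AddCommGroup V] [Module ℂ V] [FiniteDimensional ℂ V]
    (A : Module.End ℂ V) : LinearMap.charpoly (A.dualMap : Module.End ℂ (Module.Dual ℂ V)) =
      A.charpoly := by
  classical
  set b := Module.finBasis ℂ V
  rw [← LinearMap.charpoly_toMatrix A b, ← LinearMap.charpoly_toMatrix _ b.dualBasis,
    ← Matrix.charpoly_transpose (LinearMap.toMatrix b b A)]
  congr 1
  exact LinearMap.toMatrix_transpose A

/-- The characteristic polynomial of an endomorphism which is skew with respect to a nondegenerate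
bilinear form is even or odd. -/
lemma charpoly_coeff_eq_zero_of_skew {V L : Type*} [AddCommGroup V] [Module ℂ V]
    [FiniteDimensional ℂ V] [AddCommGroup L] [Module ℂ L] (hL : Module.finrank ℂ L = 1)
    (B : V →ₗ[ℂ] V →ₗ[ℂ] L) (hB : ∀ v, (∀ w, B v w = 0) → v = 0) (A : Module.End ℂ V)
    (hA : ∀ v w, B (A v) w = -B v (A w)) {j : ℕ} (hj : Odd j) (hjn : j ≤ Module.finrank ℂ V) :
    A.charpoly.coeff (Module.finrank ℂ V - j) = 0 := by
  have : FiniteDimensional ℂ L := FiniteDimensional.of_finrank_pos (by omega)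
  let e : L ≃ₗ[ℂ] ℂ := LinearEquiv.ofFinrankEq L ℂ (by simp [hL])
  let B' : V →ₗ[ℂ] Module.Dual ℂ V := (LinearMap.compRight ℂ e.toLinearMap).comp B
  have hB' : ∀ v w, B' v w = e (B v w) := fun _ _ => rfl
  have hinj : Function.Injective B' := (injective_iff_map_eq_zero B').mpr fun v hv =>
    hB v fun w => e.map_eq_zero_iff.mp (by rw [← hB', hv]; rfl)
  let β : V ≃ₗ[ℂ] Module.Dual ℂ V :=
    LinearEquiv.ofInjectiveOfFinrankEq B' hinj Subspace.dual_finrank_eq.symm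
  have hβ : ∀ v, β v = B' v := fun _ => rfl
  -- Skewness says that the isomorphism β from V to its dual conjugates -A to the transpose of A. So
  -- A and -A share their characteristic polynomial, and a coefficient homogeneous of odd degree in
  -- A equals its own negative.
  have hconj : β.conj ((-1 : ℂ) • A) = A.dualMap := by
    refine LinearMap.ext fun f => LinearMap.ext fun w => ?_
    obtain ⟨v, rfl⟩ := β.surjective f
    rw [LinearEquiv.conj_apply_apply, LinearEquiv.symm_apply_apply, hβ]
    simp [hB', hA, hβ]
  have h1 := LinearEquiv.charpoly_conj β ((-1 : ℂ) • A)
  rw [hconj, charpoly_dualMap] at h1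
  have h2 := charpoly_coeff_smul (-1) A hjn
  rw [← h1, hj.neg_one_pow] at h2
  linear_combination (1 / 2 : ℂ) * h2

end LinearAlgebra

/-! ### A graded Nakayama lemma -/

section GradedNakayama

-- Serves to extract the degree n part of a member of an ideal with homogeneous generators.
attribute [local instance] MvPolynomial.gradedAlgebra in
lemma homogeneousComponent_mul_of_isHomogeneous {σ : Type*} {f : MvPolynomial σ ℂ} {d : ℕ}
    (hf : f.IsHomogeneous d) (r : MvPolynomial σ ℂ) (n : ℕ) :
    MvPolynomial.homogeneousComponent n (r * f) =
      if d ≤ n then MvPolynomial.homogeneousComponent (n - d) r * f else 0 := by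
  have h := DirectSum.coe_decompose_mul_of_right_mem (MvPolynomial.homogeneousSubmodule σ ℂ)
    (a := r) (b := f) (i := d) n hf
  have e : ∀ (p : MvPolynomial σ ℂ) (k : ℕ),
      (DirectSum.decompose (MvPolynomial.homogeneousSubmodule σ ℂ) p k : MvPolynomial σ ℂ) =
        MvPolynomial.homogeneousComponent k p := fun p k =>
    MvPolynomial.decomposition.decompose'_apply p k
  simpa only [e] using h

/-- If homogeneous polynomials of positive degree have no common zero
other than the origin, the polynomial ring is finite over the subring they generate. -/
lemma exists_eq_top_of_zeroLocus {σ : Type*} [Finite σ] (Gen : Set (MvPolynomial σ ℂ))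
    (hom : ∀ f ∈ Gen, ∃ d, 0 < d ∧ f.IsHomogeneous d)
    (zero : ∀ x : σ → ℂ, (∀ f ∈ Gen, MvPolynomial.eval x f = 0) → x = 0) :
    ∃ K : ℕ, ∀ N : Submodule ℂ (MvPolynomial σ ℂ),
      MvPolynomial.restrictTotalDegree σ ℂ K ≤ N → (∀ f ∈ Gen, ∀ p ∈ N, p * f ∈ N) → N = ⊤ := by
  classical
  have := Fintype.ofFinite σ
  -- The zero locus is contained in the origin, where each variable vanishes, so the Nullstellensatz
  -- applies to each variable.
  have hrad : ∀ i : σ, ∃ M, (MvPolynomial.X i : MvPolynomial σ ℂ) ^ M ∈ Ideal.span Gen := by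
    intro i
    change MvPolynomial.X i ∈ (Ideal.span Gen).radical
    rw [← MvPolynomial.vanishingIdeal_zeroLocus_eq_radical (K := ℂ),
      MvPolynomial.mem_vanishingIdeal_iff]
    intro x hx
    have : x = 0 := zero x fun f hf => by
      simpa [MvPolynomial.aeval_eq_eval] using hx f (Ideal.subset_span hf)
    simp [this]
  choose M hM using hrad
  -- A monomial of degree above `∑ i, M i` is divisible by some `X i ^ M i` and therefore lies in
  -- the ideal.
  refine ⟨∑ i, M i, fun N hN hmul => ?_⟩
  have key : ∀ n, ∀ s : σ →₀ ℕ, s.degree = n → ∀ c : ℂ, MvPolynomial.monomial s c ∈ N := by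
    intro n
    induction n using Nat.strong_induction_on with
    | _ n ih =>
      intro s hs c
      have hlow : ∀ p : MvPolynomial σ ℂ, ∀ k < n, p.IsHomogeneous k → p ∈ N := by
        intro p k hk hp
        rw [p.as_sum]
        refine N.sum_mem fun t ht => ih k hk t ?_ _
        have := hp (MvPolynomial.mem_support_iff.mp ht)
        rwa [Finsupp.degree_eq_weight_one]
      by_cases hsn : n ≤ ∑ i, M i
      · refine hN ((MvPolynomial.mem_restrictTotalDegree σ _ _).mpr ?_)
        exact (MvPolynomial.totalDegree_monomial_le _ _).trans (hs.le.trans hsn)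
      · obtain ⟨i, hi⟩ : ∃ i, M i ≤ s i := by
          by_contra! hcon
          have h1 : s.degree ≤ ∑ i, M i := by
            rw [Finsupp.degree_eq_sum]
            exact Finset.sum_le_sum fun i _ => (hcon i).le
          omega
        have hmem : MvPolynomial.monomial s c ∈ Ideal.span Gen := by
          have h1 : MvPolynomial.monomial s c =
              MvPolynomial.monomial (s - Finsupp.single i (M i)) c *
                (MvPolynomial.X i : MvPolynomial σ ℂ) ^ M i := by
            rw [MvPolynomial.X_pow_eq_monomial, MvPolynomial.monomial_mul, mul_one,
              tsub_add_cancel_of_le (by simpa using hi)]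
          rw [h1]
          exact Ideal.mul_mem_left _ _ (hM i)
        -- In degree n the product `r * f` contributes f times the degree n - d part of r, which is
        -- in N by induction since d > 0. The free factor r absorbs the ring coefficients in the
        -- span induction.
        have hcl : ∀ q ∈ Ideal.span Gen, ∀ r,
            MvPolynomial.homogeneousComponent n (r * q) ∈ N := by
          intro q hq
          induction hq using Submodule.span_induction with
          | mem f hf =>
            intro r
            obtain ⟨d, hd0, hd⟩ := hom f hf
            rw [homogeneousComponent_mul_of_isHomogeneous hd]
            split_ifs with hdn
            · exact hmul f hf _ (hlow _ (n - d) (by omega)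
                (MvPolynomial.homogeneousComponent_isHomogeneous _ _))
            · exact N.zero_mem
          | zero => simp
          | add f g _ _ hf hg =>
            intro r
            rw [mul_add, map_add]
            exact N.add_mem (hf r) (hg r)
          | smul a f _ hf =>
            intro r
            rw [smul_eq_mul, ← mul_assoc]
            exact hf _
        have h2 := hcl _ hmem 1
        rw [one_mul, MvPolynomial.homogeneousComponent_of_mem
          (MvPolynomial.isHomogeneous_monomial c hs), if_pos rfl] at h2
        exact h2
  rw [eq_top_iff]
  rintro p -
  rw [p.as_sum]
  exact N.sum_mem fun t _ => key _ t rfl _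

end GradedNakayama

/-! ### Polynomial functions and finite polynomial maps -/

section PolynomialFunctions

variable {V W : Type u} [AddCommGroup V] [Module ℂ V] [AddCommGroup W] [Module ℂ W]

lemma linear_mem_polyFun (l : V →ₗ[ℂ] ℂ) : (l : V → ℂ) ∈ polyFun V :=
  Algebra.subset_adjoin ⟨l, rfl⟩

/-- Polynomials in the coordinates of a basis, as polynomial functions. -/
noncomputable def evalPoly {σ : Type*} (b : Module.Basis σ ℂ V) :
    MvPolynomial σ ℂ →ₐ[ℂ] polyFun V :=
  MvPolynomial.aeval fun i => ⟨b.coord i, linear_mem_polyFun _⟩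

lemma evalPoly_apply {σ : Type*} (b : Module.Basis σ ℂ V) (P : MvPolynomial σ ℂ) (v : V) :
    (evalPoly b P).1 v = MvPolynomial.eval (b.repr v) P := by
  let ev : polyFun V →ₐ[ℂ] ℂ := (Pi.evalAlgHom ℂ (fun _ : V => ℂ) v).comp (polyFun V).val
  have h : ev.comp (evalPoly b) = MvPolynomial.aeval (b.repr v) :=
    MvPolynomial.algHom_ext fun i => by
      rw [AlgHom.comp_apply, evalPoly, MvPolynomial.aeval_X, MvPolynomial.aeval_X]
      rfl
  have h1 := AlgHom.congr_fun h P
  rw [MvPolynomial.aeval_eq_eval] at h1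
  exact h1

/-- Carries module generators from the polynomial ring over to polynomial functions; injectivity is
not needed for this. -/
lemma evalPoly_surjective {σ : Type*} [Finite σ] (b : Module.Basis σ ℂ V) :
    Function.Surjective (evalPoly b) := by
  have := Fintype.ofFinite σ
  rintro ⟨g, hg⟩
  induction hg using Algebra.adjoin_induction with
  | mem g hg =>
    obtain ⟨l, rfl⟩ := hg
    refine ⟨∑ i, MvPolynomial.C (l (b i)) * MvPolynomial.X i,
      Subtype.ext (funext fun v => ?_)⟩
    rw [evalPoly_apply]
    have h1 := congrArg l (b.sum_repr v)
    rw [map_sum] at h1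
    simpa [mul_comm] using h1
  | algebraMap c => exact ⟨MvPolynomial.C c, Subtype.ext (funext fun v => by
      rw [evalPoly_apply]; simp)⟩
  | add f g hf hg h1 h2 =>
    obtain ⟨P, hP⟩ := h1
    obtain ⟨Q, hQ⟩ := h2
    exact ⟨P + Q, by rw [map_add, hP, hQ]; rfl⟩
  | mul f g hf hg h1 h2 =>
    obtain ⟨P, hP⟩ := h1
    obtain ⟨Q, hQ⟩ := h2
    exact ⟨P * Q, by rw [map_mul, hP, hQ]; rfl⟩

/-- Linear functionals generate the polynomial functions on W, and composition with h respects sums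
and products. -/
lemma isPolynomialMap_of_linear {h : V → W} (hl : ∀ l : W →ₗ[ℂ] ℂ, l ∘ h ∈ polyFun V) :
    IsPolynomialMap h := by
  intro g hg
  induction hg using Algebra.adjoin_induction with
  | mem g hg =>
    obtain ⟨l, rfl⟩ := hg
    exact hl l
  | algebraMap c => exact (polyFun V).algebraMap_mem c
  | add f g _ _ h1 h2 => exact (polyFun V).add_mem h1 h2
  | mul f g _ _ h1 h2 => exact (polyFun V).mul_mem h1 h2

/-- A polynomial map with homogeneous components of positive degrees, vanishing only at the origin,
is finite. -/
lemma IsPolynomialMap.finite_pullback {h : V → W} (hh : IsPolynomialMap h) {σ κ : Type*} [Finite σ]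
    (b : Module.Basis σ ℂ V) (l : κ → W →ₗ[ℂ] ℂ) (P : κ → MvPolynomial σ ℂ)
    (hP : ∀ k v, l k (h v) = MvPolynomial.eval (b.repr v) (P k))
    (hom : ∀ k, ∃ d, 0 < d ∧ (P k).IsHomogeneous d) (zero : ∀ v, (∀ k, l k (h v) = 0) → v = 0) :
    hh.pullback.Finite := by
  classical
  have := Fintype.ofFinite σ
  obtain ⟨K, hK⟩ := exists_eq_top_of_zeroLocus (Set.range P) (by rintro _ ⟨k, rfl⟩; exact hom k)
    (fun x hx => by
      have h1 := zero (b.equivFun.symm x) fun k => by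
        rw [hP, ← b.equivFun_apply, LinearEquiv.apply_symm_apply]
        exact hx _ ⟨k, rfl⟩
      exact (LinearEquiv.map_eq_zero_iff _).mp h1)
  let := hh.pullback.toAlgebra
  have hsm : ∀ (g : polyFun W) (f : polyFun V), g • f = hh.pullback g * f := fun _ _ => rfl
  obtain ⟨s, hs⟩ := (Submodule.fg_iff_finiteDimensional
    (MvPolynomial.restrictTotalDegree σ ℂ K)).mpr inferInstance
  let M : Submodule (polyFun W) (polyFun V) :=
    Submodule.span (polyFun W) (s.image (evalPoly b) : Finset (polyFun V))
  -- N consists of the polynomials whose functions lie in the span M of those of degree at most K.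
  -- It is stable under `P k`, which is the pullback of the functional `l k`, so graded Nakayama
  -- gives N = ⊤.
  let N : Submodule ℂ (MvPolynomial σ ℂ) :=
    { carrier := {p | evalPoly b p ∈ M}
      add_mem' := fun hp hq => by
        rw [Set.mem_ofPred_eq, map_add]
        exact M.add_mem hp hq
      zero_mem' := by
        rw [Set.mem_ofPred_eq, map_zero]
        exact M.zero_mem
      smul_mem' := fun c p hp => by
        have h1 : evalPoly b (c • p) = (algebraMap ℂ (polyFun W) c) • evalPoly b p := by
          rw [hsm, map_smul]
          exact Subtype.ext (funext fun v => rfl)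
        rw [Set.mem_ofPred_eq, h1]
        exact M.smul_mem _ hp }
  have hN : N = ⊤ := by
    refine hK N ?_ ?_
    · rw [← hs, Submodule.span_le]
      exact fun p hp => Submodule.subset_span (Finset.mem_coe.mpr (Finset.mem_image_of_mem _ hp))
    · rintro _ ⟨k, rfl⟩ p hp
      have h1 : evalPoly b (p * P k) =
          (⟨l k, linear_mem_polyFun _⟩ : polyFun W) • evalPoly b p := by
        rw [hsm, map_mul, mul_comm]
        congr 1
        exact Subtype.ext (funext fun v => by rw [evalPoly_apply, ← hP]; rfl)
      change evalPoly b (p * P k) ∈ M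
      rw [h1]
      exact M.smul_mem _ hp
  refine ⟨⟨s.image (evalPoly b), eq_top_iff.mpr fun f _ => ?_⟩⟩
  obtain ⟨p, rfl⟩ := evalPoly_surjective b f
  have : p ∈ N := hN ▸ Submodule.mem_top
  exact this

/-- The closed point of the affine space of `V` given by a vector. -/
noncomputable def vectorPoint (v : V) : affineSpace V :=
  ⟨RingHom.ker ((Pi.evalRingHom (fun _ : V => ℂ) v).comp (polyFun V).val.toRingHom),
    RingHom.ker_isPrime _⟩

lemma mem_vectorPoint (v : V) (f : polyFun V) :
    f ∈ PrimeSpectrum.asIdeal (vectorPoint v) ↔ f.1 v = 0 := Iff.rfl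

/-- Linear functionals separate vectors: l - l(v) belongs to the ideal of v, and to that of w only
if l(w) = l(v). -/
lemma vectorPoint_injective : Function.Injective (vectorPoint : V → affineSpace V) := by
  intro v w h
  refine sub_eq_zero.mp ((Module.forall_dual_apply_eq_zero_iff ℂ _).mp fun l => ?_)
  let f : polyFun V := ⟨l, linear_mem_polyFun l⟩ - algebraMap ℂ (polyFun V) (l v)
  have hf : ∀ u, f.1 u = l u - l v := fun _ => rfl
  have h1 : f ∈ PrimeSpectrum.asIdeal (vectorPoint w) := by
    rw [← h, mem_vectorPoint, hf, sub_self]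
  rw [mem_vectorPoint, hf] at h1
  rw [map_sub, ← neg_sub, h1, neg_zero]

lemma IsPolynomialMap.morphism_vectorPoint {h : V → W} (hh : IsPolynomialMap h) (v : V) :
    hh.morphism (vectorPoint v) = vectorPoint (h v) := rfl

end PolynomialFunctions

/-! ### Maps with homogeneous polynomial components -/

section HomogeneousMaps

/-- If the components of a map with respect to a separating family of functionals are homogeneous
polynomials of degree `d`, then so are all its components. -/
lemma exists_isHomogeneous_of_separating {V M Y σ : Type*} [AddCommGroup V] [Module ℂ V]
    [AddCommGroup M] [Module ℂ M] [Finite σ] (b : Module.Basis σ ℂ V) (ev : Y → Module.Dual ℂ M)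
    (hsep : ∀ m, (∀ y, ev y m = 0) → m = 0) (H : V → M) {d : ℕ}
    (hH : ∀ y, ∃ P : MvPolynomial σ ℂ, P.IsHomogeneous d ∧
      ∀ v, ev y (H v) = MvPolynomial.eval (b.repr v) P) (l : Module.Dual ℂ M) :
    ∃ P : MvPolynomial σ ℂ, P.IsHomogeneous d ∧
      ∀ v, l (H v) = MvPolynomial.eval (b.repr v) P := by
  -- Homogeneous polynomials of degree d in finitely many variables give a finite dimensional space
  -- of functions, as `comp_mem_of_separating` requires; M itself may have any dimension.
  let T₀ : MvPolynomial σ ℂ →ₗ[ℂ] (V → ℂ) :=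
    LinearMap.pi fun v => (MvPolynomial.aeval (R := ℂ) (b.repr v)).toLinearMap
  have hT₀ : ∀ P v, T₀ P v = MvPolynomial.eval (b.repr v) P := fun P v => by
    simp [T₀, MvPolynomial.aeval_eq_eval]
  have hle : MvPolynomial.homogeneousSubmodule σ ℂ d ≤ MvPolynomial.restrictTotalDegree σ ℂ d :=
    fun P hP => (MvPolynomial.mem_restrictTotalDegree σ _ _).mpr
      (MvPolynomial.IsHomogeneous.totalDegree_le hP)
  have fd := Submodule.finiteDimensional_of_le hle
  obtain ⟨P, hP, h2⟩ := comp_mem_of_separating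
    ((MvPolynomial.homogeneousSubmodule σ ℂ d).map T₀) ev hsep H (fun y => by
      obtain ⟨P, hP, h1⟩ := hH y
      exact ⟨P, hP, funext fun v => (hT₀ P v).trans (h1 v).symm⟩) l
  exact ⟨P, hP, fun v => (congrFun h2 v).symm.trans (hT₀ P v)⟩

/-- The coefficients of the characteristic polynomial of a linear family of endomorphisms are
homogeneous polynomials. -/
lemma exists_isHomogeneous_charpoly_coeff {V M σ : Type*} [AddCommGroup V] [Module ℂ V]
    [AddCommGroup M] [Module ℂ M] [FiniteDimensional ℂ M] [Finite σ] (b : Module.Basis σ ℂ V)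
    (ψ : V →ₗ[ℂ] Module.End ℂ M) {j : ℕ} (hj : j ≤ Module.finrank ℂ M) :
    ∃ P : MvPolynomial σ ℂ, P.IsHomogeneous j ∧
      ∀ v, (ψ v).charpoly.coeff (Module.finrank ℂ M - j) = MvPolynomial.eval (b.repr v) P := by
  classical
  have := Fintype.ofFinite σ
  exact ⟨(ψ.polyCharpoly b).coeff (Module.finrank ℂ M - j),
    ψ.polyCharpoly_coeff_isHomogeneous b _ _ (by omega), fun v =>
      (ψ.polyCharpoly_coeff_eval b v _).symm⟩

/-- A map between vector spaces whose components with respect to separating families of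
functionals are homogeneous polynomials is a polynomial map, and it is finite if it vanishes only
at the origin. -/
theorem exists_isPolynomialMap_and_isFinite {V : Type u} [AddCommGroup V] [Module ℂ V]
    (hV : FiniteDimensional ℂ V) {n : ℕ} {W : Fin n → Type u} [∀ i, AddCommGroup (W i)]
    [∀ i, Module ℂ (W i)] (h : V → ∀ i, W i) (d : Fin n → ℕ) (hd : ∀ i, 0 < d i)
    {Y : Fin n → Type*} (ev : ∀ i, Y i → Module.Dual ℂ (W i))
    (hsep : ∀ i m, (∀ y, ev i y m = 0) → m = 0)
    (hom : ∀ (b : Module.Basis (Fin (Module.finrank ℂ V)) ℂ V) i y,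
      ∃ P : MvPolynomial (Fin (Module.finrank ℂ V)) ℂ, P.IsHomogeneous (d i) ∧
        ∀ v, ev i y (h v i) = MvPolynomial.eval (b.repr v) P) :
    ∃ hpoly : IsPolynomialMap h, (∀ v, h v = 0 → v = 0) → IsFinite hpoly.morphism := by
  let b := Module.finBasis ℂ V
  choose P hPhom hP using fun i =>
    exists_isHomogeneous_of_separating b (ev i) (hsep i) (fun v => h v i) (hom b i)
  have hpoly : IsPolynomialMap h := by
    refine isPolynomialMap_of_linear fun l => ?_
    have h1 : l ∘ h = (evalPoly b (∑ i, P i (l.comp (LinearMap.single ℂ W i)))).1 := by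
      funext v
      rw [evalPoly_apply, map_sum]
      simp_rw [← hP]
      rw [Function.comp_apply, ← Finset.univ_sum_single (h v), map_sum]
      simp
    rw [h1]
    exact Subtype.property _
  refine ⟨hpoly, fun h0 => (IsFinite.SpecMap_iff _).mpr ?_⟩
  -- All functionals on all summands are used as components; together they vanish only where h does.
  refine hpoly.finite_pullback b (κ := Σ i, Module.Dual ℂ (W i))
    (fun k => k.2.comp (LinearMap.proj k.1)) (fun k => P k.1 k.2) (fun k v => hP k.1 k.2 v)
    (fun k => ⟨_, hd k.1, hPhom k.1 k.2⟩) fun v hv => h0 v (funext fun i =>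
      (Module.forall_dual_apply_eq_zero_iff ℂ _).mp fun l => hv ⟨i, l⟩)

/-- A polynomial map vanishing on a line does not have finite fibres. -/
lemma IsPolynomialMap.not_finite_fibres {V W : Type u} [AddCommGroup V] [Module ℂ V]
    [AddCommGroup W] [Module ℂ W] {h : V → W} (hh : IsPolynomialMap h) {v : V} (hv : v ≠ 0)
    (hline : ∀ c : ℂ, h (c • v) = 0) : ¬ ∀ z, (hh.morphism ⁻¹' {z}).Finite := by
  intro hfin
  have hinj : Function.Injective fun c : ℂ => vectorPoint (c • v) :=
    vectorPoint_injective.comp (smul_left_injective ℂ hv)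
  -- The line spanned by v gives infinitely many closed points over the origin.
  refine Set.infinite_range_of_injective hinj ((hfin (vectorPoint 0)).subset ?_)
  rintro _ ⟨c, rfl⟩
  rw [Set.mem_preimage, Set.mem_singleton_iff, hh.morphism_vectorPoint, hline]

end HomogeneousMaps

/-! ### The Hitchin map and its zero fibre -/

section HitchinMap

variable {X : Type u} [TopologicalSpace X] [ChartedSpace ℂ X] [IsManifold 𝓘(ℂ) ω X] {D : Finset X}
variable (F : Type*) [NormedAddCommGroup F] [NormedSpace ℂ F] [FiniteDimensional ℂ F]
    {E : X → Type u}
    [∀ x, TopologicalSpace (E x)] [TopologicalSpace (TotalSpace F E)] [FiberBundle F E]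
    [∀ x, AddCommGroup (E x)] [∀ x, Module ℂ (E x)] [VectorBundle ℂ F E]
    [ContMDiffVectorBundle ω F E 𝓘(ℂ)]
    {L : X → Type*}
    [∀ x, TopologicalSpace (L x)] [TopologicalSpace (TotalSpace ℂ L)] [FiberBundle ℂ L]
    [∀ x, AddCommGroup (L x)] [∀ x, Module ℂ (L x)]
    {m : ℕ} (hm : Module.finrank ℂ F = 2 * m) {PE : ParabolicStructure D E}
    {φ : ∀ x, E x →ₗ[ℂ] E x →ₗ[ℂ] L x}

/-- A symplectic Higgs field in the zero fibre of the Hitchin map is nilpotent. -/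
lemma isNilpotent_of_hitchinMap_eq_zero [VectorBundle ℂ ℂ L] {PL : ParabolicStructure D L}
    (hφ : IsSymplectic F PE PL φ) {Φ : higgsFields F PE φ} (h : hitchinMap F hm PE φ Φ = 0)
    (x : X) (u : T x) : IsNilpotent (Φ.1 x u) := by
  -- Over D the field is zero by convention.
  by_cases hx : x ∈ D
  · rw [Φ.2.1 x hx]
    exact IsNilpotent.zero
  have := VectorBundle.finiteDimensional ℂ F E x
  have hfr : Module.finrank ℂ (E x) = Module.finrank ℂ F := VectorBundle.finrank_eq ℂ F E x
  have hL : Module.finrank ℂ (L x) = 1 := by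
    rw [VectorBundle.finrank_eq ℂ ℂ L x, Module.finrank_self]
  have hco : ∀ j, 0 < j → j ≤ Module.finrank ℂ (E x) →
      (Φ.1 x u).charpoly.coeff (Module.finrank ℂ (E x) - j) = 0 := by
    intro j hj0 hj
    -- The coefficient s_{2k} is the summand of index k - 1 and vanishes by hypothesis; the odd
    -- coefficients vanish by skewness.
    rcases Nat.even_or_odd' j with ⟨k, rfl | rfl⟩
    · have h1 := congrFun (congrFun (congrArg Subtype.val
        (congrFun h (⟨k - 1, by omega⟩ : Fin m))) x) u
      have e : 2 * (k - 1) + 2 = 2 * k := by omega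
      simp only [hitchinMap, charCoeff, e, ← hfr] at h1
      exact h1
    · exact charpoly_coeff_eq_zero_of_skew hL (φ x) (hφ.nondegenerate x hx) _
        (Φ.2.2.2.2 x u) ⟨k, rfl⟩ hj
  have hX : (Φ.1 x u).charpoly = Polynomial.X ^ Module.finrank ℂ (E x) := by
    ext k
    rw [Polynomial.coeff_X_pow]
    rcases lt_trichotomy k (Module.finrank ℂ (E x)) with hk | hk | hk
    · rw [if_neg hk.ne]
      have := hco (Module.finrank ℂ (E x) - k) (by omega) (by omega)
      rwa [show Module.finrank ℂ (E x) - (Module.finrank ℂ (E x) - k) = k by omega] at this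
    · have h2 := (LinearMap.charpoly_monic (Φ.1 x u)).coeff_natDegree
      rw [LinearMap.charpoly_natDegree] at h2
      rw [if_pos hk, hk, h2]
    · rw [if_neg hk.ne']
      exact Polynomial.coeff_eq_zero_of_natDegree_lt (by rwa [LinearMap.charpoly_natDegree])
  refine ⟨Module.finrank ℂ (E x), ?_⟩
  have h3 := LinearMap.aeval_self_charpoly (Φ.1 x u)
  rwa [hX, map_pow, Polynomial.aeval_X] at h3

/-- The Hitchin map vanishes at nilpotent Higgs fields. -/
lemma hitchinMap_eq_zero_of_isNilpotent {Φ : higgsFields F PE φ}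
    (h : ∀ x (u : T x), IsNilpotent (Φ.1 x u)) : hitchinMap F hm PE φ Φ = 0 := by
  refine funext fun i => Subtype.ext (funext fun x => funext fun u => ?_)
  have := VectorBundle.finiteDimensional ℂ F E x
  have hfr : Module.finrank ℂ (E x) = Module.finrank ℂ F := VectorBundle.finrank_eq ℂ F E x
  change (Φ.1 x u).charpoly.coeff (Module.finrank ℂ F - (2 * i + 2)) = 0
  rw [(h x u).charpoly_eq_X_pow_finrank, hfr, Polynomial.coeff_X_pow, if_neg (by omega)]

/-- If the Hitchin map has finite fibres, there are no nonzero nilpotent Higgs fields. -/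
lemma isStronglyVeryStable_of_finite_fibres
    (hpoly : IsPolynomialMap (hitchinMap F hm PE φ))
    (hfin : ∀ z, (hpoly.morphism ⁻¹' {z}).Finite) : IsStronglyVeryStable F PE φ := by
  intro Φ hΦ hnil
  by_contra hne
  let Φ' : higgsFields F PE φ := ⟨Φ, hΦ⟩
  have hne' : Φ' ≠ 0 := fun h0 => hne (congrArg Subtype.val h0)
  have hline : ∀ c : ℂ, hitchinMap F hm PE φ (c • Φ') = 0 := fun c =>
    hitchinMap_eq_zero_of_isNilpotent F hm fun x u => by
      obtain ⟨k, hk⟩ := hnil x u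
      exact ⟨k, by
        change (c • Φ x u) ^ k = 0
        rw [smul_pow, hk, smul_zero]⟩
  exact hpoly.not_finite_fibres hne' hline hfin

/-- The Hitchin map is a polynomial map, and it is finite if it vanishes only at the origin. -/
theorem exists_isPolynomialMap_hitchinMap [T2Space X] [CompactSpace X] :
    ∃ hpoly : IsPolynomialMap (hitchinMap F hm PE φ),
      (∀ Φ, hitchinMap F hm PE φ Φ = 0 → Φ = 0) → IsFinite hpoly.morphism := by
  refine exists_isPolynomialMap_and_isFinite (finiteDimensional_higgsFields F PE φ)
    (W := fun i : Fin m => differentials D (2 * i + 2) (2 * i + 1))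
    (hitchinMap F hm PE φ) (fun i => 2 * i + 2) (fun i => by omega) (Y := fun _ => Σ x : X, T x)
    (fun i y =>
      { toFun := fun q => q.1 y.1 y.2
        map_add' := fun _ _ => rfl
        map_smul' := fun _ _ => rfl })
    (fun i q hq => Subtype.ext (funext fun x => funext fun u => hq ⟨x, u⟩)) ?_
  rintro b i ⟨x, u⟩
  have := VectorBundle.finiteDimensional ℂ F E x
  have hfr : Module.finrank ℂ (E x) = Module.finrank ℂ F := VectorBundle.finrank_eq ℂ F E x
  -- For fixed x and u the endomorphism Φ_x(u) is linear in Φ, so its characteristic coefficients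
  -- are homogeneous polynomials in Φ.
  let ψ : higgsFields F PE φ →ₗ[ℂ] Module.End ℂ (E x) :=
    { toFun := fun Φ => Φ.1 x u
      map_add' := fun _ _ => rfl
      map_smul' := fun _ _ => rfl }
  have hj : 2 * (i : ℕ) + 2 ≤ Module.finrank ℂ (E x) := by omega
  obtain ⟨P, hP, h⟩ := exists_isHomogeneous_charpoly_coeff
    (V := higgsFields F PE φ) b ψ hj
  rw [hfr] at h
  exact ⟨P, hP, h⟩

end HitchinMap

end ParabolicHiggs

/-! ### The equivalence of the four conditions -/

theorem mainTheorem1 {X : Type u} [TopologicalSpace X] [ChartedSpace ℂ X] [IsManifold 𝓘(ℂ) ω X]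
    [T2Space X] [CompactSpace X] [ConnectedSpace X] (hgenus : 2 ≤ ParabolicHiggs.genus X)
    (D : Finset X) (m : ℕ)
    (F : Type*) [NormedAddCommGroup F] [NormedSpace ℂ F] [FiniteDimensional ℂ F]
    (hm : Module.finrank ℂ F = 2 * m)
    (E : X → Type u) [∀ x, TopologicalSpace (E x)] [TopologicalSpace (TotalSpace F E)]
    [FiberBundle F E] [∀ x, AddCommGroup (E x)] [∀ x, Module ℂ (E x)] [VectorBundle ℂ F E]
    [ContMDiffVectorBundle ω F E 𝓘(ℂ)]
    (L : X → Type*) [∀ x, TopologicalSpace (L x)] [TopologicalSpace (TotalSpace ℂ L)]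
    [FiberBundle ℂ L] [∀ x, AddCommGroup (L x)] [∀ x, Module ℂ (L x)] [VectorBundle ℂ ℂ L]
    [ContMDiffVectorBundle ω ℂ L 𝓘(ℂ)]
    (PE : ParabolicHiggs.ParabolicStructure D E) (PL : ParabolicHiggs.ParabolicStructure D L)
    (φ : ∀ x, E x →ₗ[ℂ] E x →ₗ[ℂ] L x) (hφ : ParabolicHiggs.IsSymplectic F PE PL φ)
    (hstable : ParabolicHiggs.IsStable F PE φ) :
    ∃ hpoly : ParabolicHiggs.IsPolynomialMap (ParabolicHiggs.hitchinMap F hm PE φ),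
      [ParabolicHiggs.IsStronglyVeryStable F PE φ,
        IsFinite hpoly.morphism,
        IsProper hpoly.morphism,
        ParabolicHiggs.IsQuasiFinite hpoly.morphism].TFAE := by
  obtain ⟨hpoly, hfin⟩ := ParabolicHiggs.exists_isPolynomialMap_hitchinMap F hm (PE := PE) (φ := φ)
  refine ⟨hpoly, ?_⟩
  tfae_have 1 → 2 := fun hst => hfin fun Φ h0 => Subtype.ext (hst Φ.1 Φ.2
    (ParabolicHiggs.isNilpotent_of_hitchinMap_eq_zero F hm hφ h0))
  tfae_have 2 → 3 := fun h => inferInstance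
  -- A morphism of affine schemes is affine, and proper together with affine is finite.
  tfae_have 3 → 2 := fun h => IsFinite.iff_isProper_and_isAffineHom.mpr ⟨h, by
    unfold ParabolicHiggs.IsPolynomialMap.morphism ParabolicHiggs.affineSpace
    infer_instance⟩
  tfae_have 2 → 4 := fun h =>
    ⟨inferInstance, inferInstance, fun z => Scheme.Hom.finite_preimage_singleton _ z⟩
  tfae_have 4 → 1 := fun h =>
    ParabolicHiggs.isStronglyVeryStable_of_finite_fibres F hm hpoly h.2.2
  tfae_finish
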